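/- **Setting.** Superscripts $*$, $\mathrm T$, $\mathrm H$, $\dagger$ denote conjugate, transpose, conjugate transpose and Moore–Penrose pseudoinverse; $\otimes$ and $\odot$ are the Kronecker and the Khatri–Rao (columnwise Kronecker) products, $\jmath=\sqrt{-1}$, and $\Im$ is taken entrywise. There are $L$ paths. Path $l$ has departure angles $(\phi^l_{\rm az},\phi^l_{\rm el})$, arrival angles $(\theta^l_{\rm az},\theta^l_{\rm el})$, delay $\tau_l$ and gain $\gamma_l\in\mathbb C\setminus\{0\}$, and angular frequencies $$\omega_{l,1}=\pi\sin\phi^l_{\rm az}\sin\phi^l_{\rm el},\quad \omega_{l,2}=\pi\cos\phi^l_{\rm el},\quad \omega_{l,3}=\pi\sin\theta^l_{\rm az}\sin\theta^l_{\rm el},\quad \omega_{l,4}=\pi\cos\theta^l_{\rm el},\quad \omega_{l,5}=-2\pi\Delta f\,\tau_l ,$$ with subcarrier spacing $\Delta f>0$; put $\Phi_{l,n}=e^{\jmath\omega_{l,n}}$ and $\boldsymbol\Phi_n=\mathrm{Diag}(\Phi_{1,n},\dots,\Phi_{L,n})$. The parameters lie in open regions (one for departure angles, one for arrival angles, one for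 delays) on which $(\mathrm{az},\mathrm{el})\mapsto(\pi\sin\mathrm{az}\sin\mathrm{el},\pi\cos\mathrm{el})$, respectively $\tau\mapsto e^{-\jmath2\pi\Delta f\tau}$, is one-to-one, and $\cos\phi^l_{\rm az},\sin\phi^l_{\rm el},\cos\theta^l_{\rm az},\sin\theta^l_{\rm el}\neq0$. Let $\boldsymbol A_n^{(q)}\in\mathbb C^{q\times L}$ have entries $e^{\jmath m\omega_{l,n}}$, $0\le m<q$. For $n\le4$ let $\boldsymbol T_n\in\mathbb C^{M_n\times N_n}$, $\boldsymbol T_n^{\rm H}=[\boldsymbol t_{n,1},\dots,\boldsymbol t_{n,M_n}]$, have the shift invariance structure $[\boldsymbol I,\boldsymbol 0]\boldsymbol T_n=[\boldsymbol 0,\boldsymbol I]\boldsymbol T_n\boldsymbol F_n$ with $\boldsymbol F_n$ non-singular, let $\boldsymbol Q_n\in\mathbb C^{N_n\times N_n}$ satisfy $\boldsymbol Q_n\boldsymbol t_{n,M_n}=\boldsymbol 0$ and $\boldsymbol Q_n\boldsymbol F_n^{\rm H}\boldsymbol t_{n,1}=\boldsymbol 0$, and put $\boldsymbol L_{n,1}=\boldsymbol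 Q_n$, $\boldsymbol L_{n,2}=\boldsymbol Q_n\boldsymbol F_n^{\rm H}$; $\boldsymbol T_5=\boldsymbol I_{M_5}$. Put $\boldsymbol B_n=\boldsymbol T_n^{\rm H}\boldsymbol A_n^{(M_n)}$, $\boldsymbol B=\boldsymbol B_1\odot\cdots\odot\boldsymbol B_5$, and, for $L_5+K_5=M_5+1$, $\boldsymbol P=\boldsymbol B_1\odot\cdots\odot\boldsymbol B_4\odot\boldsymbol A_5^{(K_5)}$, $\boldsymbol G=\boldsymbol A_5^{(L_5)}$. Let $\breve{\boldsymbol J}_{n,i}$ be $\boldsymbol I\otimes\cdots\otimes\boldsymbol L_{n,i}\otimes\cdots\otimes\boldsymbol I_{K_5}$ (with $\boldsymbol L_{n,i}$ in position $n$) for $n\le4$, and $\breve{\boldsymbol J}_{5,1}=\boldsymbol I\otimes[\boldsymbol I_{K_5-1},\boldsymbol 0]$, $\breve{\boldsymbol J}_{5,2}=\boldsymbol I\otimes[\boldsymbol 0,\boldsymbol I_{K_5-1}]$. Assume that $\breve{\boldsymbol J}_{n,1}\boldsymbol P$ ($n=1,\dots,5$) and $\boldsymbol G$ have full column rank $L$.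 **Estimator.** The noiseless beamspace channel is $\boldsymbol h=\boldsymbol B\boldsymbol\gamma$, and $\tilde{\boldsymbol h}=\boldsymbol h+\Delta\boldsymbol h$ is observed. Let $\mathcal S(\tilde{\boldsymbol h})\in\mathbb C^{N_1N_2N_3N_4K_5\times L_5}$ be the spatially smoothed matrix, whose entry in row $(n_1,\dots,n_4,k)$ and column $\ell$ is $\tilde h_{n_1,\dots,n_4,k+\ell-1}$. Matrix-based beamspace ESPRIT takes $L$ leading left singular vectors $\tilde{\boldsymbol U}_{\rm s}$ of $\mathcal S(\tilde{\boldsymbol h})$, forms $\tilde{\boldsymbol\Gamma}_n=(\breve{\boldsymbol J}_{n,1}\tilde{\boldsymbol U}_{\rm s})^\dagger\breve{\boldsymbol J}_{n,2}\tilde{\boldsymbol U}_{\rm s}$, diagonalizes $\sum_n\beta_n\tilde{\boldsymbol\Gamma}_n=\tilde{\boldsymbol E}\tilde{\boldsymbol\Lambda}\tilde{\boldsymbol E}^{-1}$, where the weights $\beta_n$ are such that the numbers $\sum_n\beta_n\Phi_{l,n}$ ($l=1,\dots,L$) are distinct, sets $\hat\omega_{l,n}=\Im\ln(\tilde{\boldsymbol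 E}^{-1}\tilde{\boldsymbol\Gamma}_n\tilde{\boldsymbol E})_{l,l}$, takes for the estimated angles and delays the points of the given regions that correspond to the $\hat\omega_{l,n}$ (for $n=5$ modulo $2\pi$), and sets $\hat{\boldsymbol\gamma}=\hat{\boldsymbol B}^\dagger\tilde{\boldsymbol h}$, where $\hat{\boldsymbol B}$ is $\boldsymbol B$ with every $\omega_{l,n}$ replaced by $\hat\omega_{l,n}$. **Notation.** Let $\boldsymbol b_l$ be the $l$-th column of $\boldsymbol I_L$, and let $\boldsymbol\lambda_{l,n}^{\rm H}=\boldsymbol b_l^{\rm T}(\breve{\boldsymbol J}_{n,1}\boldsymbol P)^\dagger(\breve{\boldsymbol J}_{n,2}-\Phi_{l,n}\breve{\boldsymbol J}_{n,1})$ and $\boldsymbol\chi_l^*=(\boldsymbol G^{\rm T})^\dagger\boldsymbol b_l$. Let $\boldsymbol\xi_{l,n}$ be the vector whose length-$M_5$ blocks (indexed by $(n_1,\dots,n_4)$) are the convolutions of the length-$K_5$ blocks of $\boldsymbol\lambda_{l,n}$ with $\boldsymbol\chi_l$. Put $\boldsymbol\upsilon_{l,n}=\Phi_{l,n}\boldsymbol\xi_{l,n}/\gamma_l^*$,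 $\boldsymbol V_n=[\boldsymbol\upsilon_{1,n},\dots,\boldsymbol\upsilon_{L,n}]$, $\breve{\boldsymbol T}_n=-\jmath\,\mathrm{Diag}(0,1,\dots,M_n-1)\boldsymbol T_n$, let $\breve{\boldsymbol B}_n$ be $\boldsymbol B$ with its $n$-th Khatri–Rao factor replaced by $\breve{\boldsymbol T}_n^{\rm H}\boldsymbol A_n^{(M_n)}$, and put $\boldsymbol\Upsilon_n=\boldsymbol B^\dagger\breve{\boldsymbol B}_n\odot\boldsymbol\gamma^{\rm T}\in\mathbb C^{L\times L}$. Finally let $$\boldsymbol\kappa_{l,1}=\frac{\boldsymbol\upsilon_{l,1}}{\pi\cos\phi^l_{\rm az}\sin\phi^l_{\rm el}}+\frac{\sin\phi^l_{\rm az}\cos\phi^l_{\rm el}\,\boldsymbol\upsilon_{l,2}}{\pi\cos\phi^l_{\rm az}\sin^2\phi^l_{\rm el}},\qquad \boldsymbol\kappa_{l,2}=-\frac{\boldsymbol\upsilon_{l,2}}{\pi\sin\phi^l_{\rm el}},$$ $$\boldsymbol\kappa_{l,3}=\frac{\boldsymbol\upsilon_{l,3}}{\pi\cos\theta^l_{\rm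 az}\sin\theta^l_{\rm el}}+\frac{\sin\theta^l_{\rm az}\cos\theta^l_{\rm el}\,\boldsymbol\upsilon_{l,4}}{\pi\cos\theta^l_{\rm az}\sin^2\theta^l_{\rm el}},\qquad \boldsymbol\kappa_{l,4}=-\frac{\boldsymbol\upsilon_{l,4}}{\pi\sin\theta^l_{\rm el}},\qquad \boldsymbol\kappa_{l,5}=-\frac{\boldsymbol\upsilon_{l,5}}{2\pi\Delta f}.$$ **Lemma.** For any choice of outputs of the algorithm for $\Delta\boldsymbol h$ near $\boldsymbol0$, and after a suitable relabelling of the estimated paths (a permutation that may depend on $\Delta\boldsymbol h$), the errors of the estimates are, for every $l$ and as $\Delta\boldsymbol h\to\boldsymbol0$, $$\hat\phi^l_{\rm az}-\phi^l_{\rm az}=\Im\{\boldsymbol\kappa_{l,1}^{\rm H}\Delta\boldsymbol h\}+o(\|\Delta\boldsymbol h\|),\qquad \hat\phi^l_{\rm el}-\phi^l_{\rm el}=\Im\{\boldsymbol\kappa_{l,2}^{\rm H}\Delta\boldsymbol h\}+o(\|\Delta\boldsymbol h\|),$$ $$\hat\theta^l_{\rm az}-\theta^l_{\rm az}=\Im\{\boldsymbol\kappa_{l,3}^{\rm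 H}\Delta\boldsymbol h\}+o(\|\Delta\boldsymbol h\|),\qquad \hat\theta^l_{\rm el}-\theta^l_{\rm el}=\Im\{\boldsymbol\kappa_{l,4}^{\rm H}\Delta\boldsymbol h\}+o(\|\Delta\boldsymbol h\|),$$ $$\hat\tau_l-\tau_l=\Im\{\boldsymbol\kappa_{l,5}^{\rm H}\Delta\boldsymbol h\}+o(\|\Delta\boldsymbol h\|),$$ $$\hat\gamma_l-\gamma_l=\boldsymbol b_l^{\rm T}\boldsymbol B^\dagger\Delta\boldsymbol h-\sum_{n=1}^5\boldsymbol b_l^{\rm T}\boldsymbol\Upsilon_n\,\Im\{\boldsymbol V_n^{\rm H}\Delta\boldsymbol h\}+o(\|\Delta\boldsymbol h\|).$$ -/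

import Mathlib

open Filter Topology Asymptotics
open scoped Matrix

noncomputable section

namespace BeamESPRIT

section PseudoInverse

variable {m n : Type*} [Fintype m] [Fintype n]

/-- The four Penrose conditions: `X` is the Moore-Penrose pseudoinverse of `A`. -/
def IsMoorePenrose (A : Matrix m n ℂ) (X : Matrix n m ℂ) : Prop :=
  A * X * A = A ∧ X * A * X = X ∧ (A * X).IsHermitian ∧ (X * A).IsHermitian

theorem IsMoorePenrose.unique {A : Matrix m n ℂ} {X Y : Matrix n m ℂ}
    (hX : IsMoorePenrose A X) (hY : IsMoorePenrose A Y) : X = Y := by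
  obtain ⟨x1, x2, x3, x4⟩ := hX
  obtain ⟨y1, y2, y3, y4⟩ := hY
  have hA : A * X = A * Y := by
    calc A * X = (A * X)ᴴ := x3.eq.symm
      _ = ((A * Y) * (A * X))ᴴ := by rw [← Matrix.mul_assoc, y1]
      _ = (A * X)ᴴ * (A * Y)ᴴ := by rw [Matrix.conjTranspose_mul]
      _ = (A * X) * (A * Y) := by rw [x3.eq, y3.eq]
      _ = A * Y := by rw [← Matrix.mul_assoc, x1]
  have hB : X * A = Y * A := by
    calc X * A = (X * A)ᴴ := x4.eq.symm
      _ = ((X * A) * (Y * A))ᴴ := by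
          rw [Matrix.mul_assoc X A, ← Matrix.mul_assoc A Y, y1]
      _ = (Y * A)ᴴ * (X * A)ᴴ := by rw [Matrix.conjTranspose_mul]
      _ = (Y * A) * (X * A) := by rw [x4.eq, y4.eq]
      _ = Y * A := by rw [Matrix.mul_assoc Y A, ← Matrix.mul_assoc A X, x1]
  calc X = X * A * X := x2.symm
    _ = Y * (A * X) := by rw [hB, Matrix.mul_assoc]
    _ = Y := by rw [hA, ← Matrix.mul_assoc, y2]

theorem exists_isMoorePenrose_of_isHermitian {H : Matrix n n ℂ} (hH : H.IsHermitian) :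
    ∃ Y : Matrix n n ℂ, Y.IsHermitian ∧ H * Y * H = H ∧ Y * H * Y = Y ∧ H * Y = Y * H := by
  classical
  let U : Matrix n n ℂ := hH.eigenvectorUnitary
  let d : n → ℂ := fun i => (hH.eigenvalues i : ℂ)
  have hU : Uᴴ * U = 1 := Unitary.coe_star_mul_self hH.eigenvectorUnitary
  have hs : H = U * Matrix.diagonal d * Uᴴ := by
    have h := hH.spectral_theorem
    rw [Unitary.conjStarAlgAut_apply] at h
    exact h
  have key : ∀ a b : n → ℂ, (U * Matrix.diagonal a * Uᴴ) * (U * Matrix.diagonal b * Uᴴ)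
      = U * Matrix.diagonal (fun i => a i * b i) * Uᴴ := by
    intro a b
    calc (U * Matrix.diagonal a * Uᴴ) * (U * Matrix.diagonal b * Uᴴ)
        = U * Matrix.diagonal a * (Uᴴ * U) * Matrix.diagonal b * Uᴴ := by
          simp only [Matrix.mul_assoc]
      _ = U * (Matrix.diagonal a * Matrix.diagonal b) * Uᴴ := by
          rw [hU, Matrix.mul_one, Matrix.mul_assoc U]
      _ = _ := by rw [Matrix.diagonal_mul_diagonal]
  refine ⟨U * Matrix.diagonal (fun i => (d i)⁻¹) * Uᴴ, ?_, ?_, ?_, ?_⟩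
  · have hd : star (fun i => (d i)⁻¹) = fun i => (d i)⁻¹ := by
      funext i
      simp [d]
    simp only [Matrix.IsHermitian, Matrix.conjTranspose_mul, Matrix.conjTranspose_conjTranspose,
      Matrix.diagonal_conjTranspose, hd, Matrix.mul_assoc]
  · conv_rhs => rw [hs]
    conv_lhs => rw [hs]
    rw [key, key]
    congr 3
    funext i
    by_cases h : d i = 0 <;> simp [h]
  · conv_lhs => rw [hs]
    rw [key, key]
    congr 3
    funext i
    by_cases h : d i = 0 <;> simp [h]
  · conv_lhs => rw [hs]
    conv_rhs => rw [hs]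
    rw [key, key]
    congr 3
    funext i
    ring

open scoped ComplexOrder in
theorem exists_isMoorePenrose (A : Matrix m n ℂ) : ∃ X, IsMoorePenrose A X := by
  classical
  obtain ⟨Y, hY, h1, h2, h3⟩ :=
    exists_isMoorePenrose_of_isHermitian (Matrix.isHermitian_conjTranspose_mul_self A)
  have hA : A * Y * (Aᴴ * A) = A := by
    have h0 : (A - A * Y * (Aᴴ * A))ᴴ * (A - A * Y * (Aᴴ * A)) = 0 := by
      have e : Aᴴ * (A - A * Y * (Aᴴ * A)) = 0 := by
        rw [Matrix.mul_sub, sub_eq_zero]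
        calc Aᴴ * A = Aᴴ * A * Y * (Aᴴ * A) := h1.symm
          _ = Aᴴ * (A * Y * (Aᴴ * A)) := by simp only [Matrix.mul_assoc]
      have e2 : (A * Y * (Aᴴ * A))ᴴ = (Aᴴ * A) * Y * Aᴴ := by
        simp only [Matrix.conjTranspose_mul, Matrix.conjTranspose_conjTranspose, hY.eq,
          Matrix.mul_assoc]
      rw [Matrix.conjTranspose_sub, Matrix.sub_mul, e, e2, Matrix.mul_assoc, e]
      simp
    exact (sub_eq_zero.mp (Matrix.conjTranspose_mul_self_eq_zero.mp h0)).symm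
  refine ⟨Y * Aᴴ, ?_, ?_, ?_, ?_⟩
  · calc A * (Y * Aᴴ) * A = A * Y * (Aᴴ * A) := by simp only [Matrix.mul_assoc]
      _ = A := hA
  · calc Y * Aᴴ * A * (Y * Aᴴ) = (Y * (Aᴴ * A) * Y) * Aᴴ := by simp only [Matrix.mul_assoc]
      _ = Y * Aᴴ := by rw [h2]
  · simp only [Matrix.IsHermitian, Matrix.conjTranspose_mul, Matrix.conjTranspose_conjTranspose,
      hY.eq, Matrix.mul_assoc]
  · simp only [Matrix.IsHermitian, Matrix.conjTranspose_mul, Matrix.conjTranspose_conjTranspose,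
      hY.eq, Matrix.mul_assoc]
    rw [← Matrix.mul_assoc, h3]

/-- The Moore-Penrose pseudoinverse `A†` of a complex matrix. -/
def pinv (A : Matrix m n ℂ) : Matrix n m ℂ := Classical.choose (exists_isMoorePenrose A)

theorem pinv_spec (A : Matrix m n ℂ) : IsMoorePenrose A (pinv A) :=
  Classical.choose_spec (exists_isMoorePenrose A)

theorem pinv_eq {A : Matrix m n ℂ} {X : Matrix n m ℂ} (h : IsMoorePenrose A X) : pinv A = X :=
  (pinv_spec A).unique h

end PseudoInverse

/-! ### Channel model

The four spatial modes `1, …, 4` are indexed by `Fin 4`, all five modes by `Fin 5` (so the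
frequency mode is `4 : Fin 5`), the paths by `Fin L`. Positions within a mode are counted
from `0`. -/

/-- Index set of the row-vectorized beamspace tensors, `(n₁, n₂, n₃, n₄, m)`. -/
abbrev Idx (N : Fin 4 → ℕ) (q : ℕ) : Type := (∀ k : Fin 4, Fin (N k)) × Fin q

/-- The physical parameters of the `L` propagation paths: angles of departure `φ`, angles of
arrival `θ` (azimuth and elevation), delays and complex gains. -/
structure ChannelParams (L : ℕ) where
  phiAz : Fin L → ℝ
  phiEl : Fin L → ℝ
  thetaAz : Fin L → ℝ
  thetaEl : Fin L → ℝ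
  tau : Fin L → ℝ
  gain : Fin L → ℂ

/-- The two spatial frequencies of a direction `x = (azimuth, elevation)`. -/
def angleFreq (x : ℝ × ℝ) : ℝ × ℝ :=
  (Real.pi * Real.sin x.1 * Real.sin x.2, Real.pi * Real.cos x.2)

/-- `exp(jω)`. -/
def phase (ω : ℝ) : ℂ := Complex.exp (Complex.I * ω)

/-- The angular frequencies `ω_{l,n}`; `Δf` is the subcarrier spacing. -/
def ChannelParams.freq {L : ℕ} (p : ChannelParams L) (Δf : ℝ) (l : Fin L) : Fin 5 → ℝ :=
  ![(angleFreq (p.phiAz l, p.phiEl l)).1, (angleFreq (p.phiAz l, p.phiEl l)).2,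
    (angleFreq (p.thetaAz l, p.thetaEl l)).1, (angleFreq (p.thetaAz l, p.thetaEl l)).2,
    -(2 * Real.pi * Δf * p.tau l)]

/-- A region of admissible parameters on which the map from the parameters to the angular
frequencies is one-to-one (for the delay: to the angular frequency modulo `2π`). -/
structure ParamRegion (Δf : ℝ) where
  departure : Set (ℝ × ℝ)
  arrival : Set (ℝ × ℝ)
  delay : Set ℝ
  isOpen_departure : IsOpen departure
  isOpen_arrival : IsOpen arrival
  isOpen_delay : IsOpen delay
  injOn_departure : Set.InjOn angleFreq departure
  injOn_arrival : Set.InjOn angleFreq arrival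
  injOn_delay : Set.InjOn (fun τ : ℝ => phase (-(2 * Real.pi * Δf * τ))) delay

/-- All paths have their parameters in the region. -/
def ParamRegion.Contains {L : ℕ} {Δf : ℝ} (R : ParamRegion Δf) (p : ChannelParams L) : Prop :=
  ∀ l, (p.phiAz l, p.phiEl l) ∈ R.departure ∧ (p.thetaAz l, p.thetaEl l) ∈ R.arrival ∧
    p.tau l ∈ R.delay

section Matrices

variable {L : ℕ} {M N : Fin 4 → ℕ}

/-- The `q × L` Vandermonde matrix `A^{(q)} = [a^{(q)}(ω₁), …, a^{(q)}(ω_L)]`. -/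
def vander (q : ℕ) (ω : Fin L → ℝ) : Matrix (Fin q) (Fin L) ℂ :=
  Matrix.of fun m l => Complex.exp (Complex.I * (m : ℕ) * ω l)

/-- Khatri-Rao (columnwise Kronecker) product `C₁ ⊙ C₂ ⊙ C₃ ⊙ C₄ ⊙ D`. -/
def khatriRao {q : ℕ} (C : ∀ k : Fin 4, Matrix (Fin (N k)) (Fin L) ℂ)
    (D : Matrix (Fin q) (Fin L) ℂ) : Matrix (Idx N q) (Fin L) ℂ :=
  Matrix.of fun i l => (∏ k, C k (i.1 k) l) * D i.2 l

/-- Kronecker product `X₁ ⊗ X₂ ⊗ X₃ ⊗ X₄ ⊗ Y`. -/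
def kron {a b : ℕ} (X : ∀ k : Fin 4, Matrix (Fin (N k)) (Fin (N k)) ℂ)
    (Y : Matrix (Fin a) (Fin b) ℂ) : Matrix (Idx N a) (Idx N b) ℂ :=
  Matrix.of fun i j => (∏ k, X k (i.1 k) (j.1 k)) * Y i.2 j.2

/-- The selection matrix `[I, 0]`. -/
def selFirst (q : ℕ) : Matrix (Fin (q - 1)) (Fin q) ℂ :=
  Matrix.of fun i j => if (j : ℕ) = i then 1 else 0

/-- The selection matrix `[0, I]`. -/
def selLast (q : ℕ) : Matrix (Fin (q - 1)) (Fin q) ℂ :=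
  Matrix.of fun i j => if (j : ℕ) = i + 1 then 1 else 0

/-- The transformation matrix `T` has the shift invariance structure with the non-singular
matrix `F`, and `Q` annihilates the two boundary terms; the `m`-th column of `Tᴴ` is `t_m`. -/
structure RestoresShiftInvariance {a b : ℕ} (T : Matrix (Fin a) (Fin b) ℂ)
    (F Q : Matrix (Fin b) (Fin b) ℂ) : Prop where
  isUnit_det : IsUnit F.det
  shift : selFirst a * T = selLast a * T * F
  last : ∀ m : Fin a, (m : ℕ) + 1 = a → Q *ᵥ (Tᴴ.col m) = 0
  first : ∀ m : Fin a, (m : ℕ) = 0 → (Q * Fᴴ) *ᵥ (Tᴴ.col m) = 0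

/-- `B_n = T_nᴴ A_n` for the spatial modes. -/
def modeMat (T : ∀ k, Matrix (Fin (M k)) (Fin (N k)) ℂ) (ω : Fin L → Fin 5 → ℝ) (k : Fin 4) :
    Matrix (Fin (N k)) (Fin L) ℂ :=
  (T k)ᴴ * vander (M k) fun l => ω l k.castSucc

/-- `B₁ ⊙ B₂ ⊙ B₃ ⊙ B₄ ⊙ A₅^{(q)}`: this is the matrix `B` for `q = M₅` and the matrix `P` for
`q = K₅`. -/
def beamMat (T : ∀ k, Matrix (Fin (M k)) (Fin (N k)) ℂ) (ω : Fin L → Fin 5 → ℝ) (q : ℕ) :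
    Matrix (Idx N q) (Fin L) ℂ :=
  khatriRao (modeMat T ω) (vander q fun l => ω l (Fin.last 4))

/-- `T̆ = -j Diag(0, 1, …, a - 1) T`. -/
def derivT {a : ℕ} {ι : Type*} (T : Matrix (Fin a) ι ℂ) : Matrix (Fin a) ι ℂ :=
  (-Complex.I) • (Matrix.diagonal (fun m : Fin a => ((m : ℕ) : ℂ)) * T)

/-- `B̆_n`: the `n`-th factor of `B` is replaced by `T̆_nᴴ A_n`, where `T₅ = I`. -/
def derivBeamMat (T : ∀ k, Matrix (Fin (M k)) (Fin (N k)) ℂ) (ω : Fin L → Fin 5 → ℝ) (q : ℕ) :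
    Fin 5 → Matrix (Idx N q) (Fin L) ℂ :=
  Fin.snoc (α := fun _ => Matrix (Idx N q) (Fin L) ℂ)
    (fun k => khatriRao
      (Function.update (modeMat T ω) k
        ((derivT (T k))ᴴ * vander (M k) fun l => ω l k.castSucc))
      (vander q fun l => ω l (Fin.last 4)))
    (khatriRao (modeMat T ω)
      ((derivT (1 : Matrix (Fin q) (Fin q) ℂ))ᴴ * vander q fun l => ω l (Fin.last 4)))

/-- The noiseless beamspace channel vector `h = B γ`. -/
def channel (T : ∀ k, Matrix (Fin (M k)) (Fin (N k)) ℂ) (Δf : ℝ) (M₅ : ℕ)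
    (p : ChannelParams L) : Idx N M₅ → ℂ :=
  beamMat T (p.freq Δf) M₅ *ᵥ p.gain

/-- Spatial smoothing over the frequency mode: the `ℓ`-th column of `𝒮(h)` is obtained from `h`
by keeping the frequency positions `ℓ, …, ℓ + K₅ - 1`. -/
def smooth (K₅ L₅ : ℕ) {M₅ : ℕ} (h : Idx N M₅ → ℂ) : Matrix (Idx N K₅) (Fin L₅) ℂ :=
  Matrix.of fun i ℓ => ∑ m : Fin M₅, if (m : ℕ) = (i.2 : ℕ) + ℓ then h (i.1, m) else 0

/-- `J̆_{n,1}` for the spatial mode `k`, with `L_{n,1} = Q_n`. -/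
def J₁ (Q : ∀ k, Matrix (Fin (N k)) (Fin (N k)) ℂ) (q : ℕ) (k : Fin 4) :
    Matrix (Idx N q) (Idx N q) ℂ :=
  kron (Function.update (fun k' => (1 : Matrix (Fin (N k')) (Fin (N k')) ℂ)) k (Q k))
    (1 : Matrix (Fin q) (Fin q) ℂ)

/-- `J̆_{n,2}` for the spatial mode `k`, with `L_{n,2} = Q_n F_nᴴ`. -/
def J₂ (F Q : ∀ k, Matrix (Fin (N k)) (Fin (N k)) ℂ) (q : ℕ) (k : Fin 4) :
    Matrix (Idx N q) (Idx N q) ℂ :=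
  kron (Function.update (fun k' => (1 : Matrix (Fin (N k')) (Fin (N k')) ℂ)) k (Q k * (F k)ᴴ))
    (1 : Matrix (Fin q) (Fin q) ℂ)

/-- `J̆_{5,1}`. -/
def J₁freq (N : Fin 4 → ℕ) (q : ℕ) : Matrix (Idx N (q - 1)) (Idx N q) ℂ :=
  kron (fun k => (1 : Matrix (Fin (N k)) (Fin (N k)) ℂ)) (selFirst q)

/-- `J̆_{5,2}`. -/
def J₂freq (N : Fin 4 → ℕ) (q : ℕ) : Matrix (Idx N (q - 1)) (Idx N q) ℂ :=
  kron (fun k => (1 : Matrix (Fin (N k)) (Fin (N k)) ℂ)) (selLast q)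

/-! ### The estimation algorithm -/

/-- The columns of `U` are `L` leading left singular vectors of `H`: there is a singular value
decomposition `H = U Σ Vᴴ + U' Σ' V'ᴴ` whose singular values in `Σ'` do not exceed those
in `Σ`. -/
def IsLeadingLeftSingular {r c : Type*} [Fintype r] [Fintype c] (H : Matrix r c ℂ)
    (U : Matrix r (Fin L) ℂ) : Prop :=
  ∃ (V : Matrix c (Fin L) ℂ) (s : Fin L → ℝ) (d : ℕ) (U' : Matrix r (Fin d) ℂ)
    (V' : Matrix c (Fin d) ℂ) (s' : Fin d → ℝ),
    Uᴴ * U = 1 ∧ U'ᴴ * U' = 1 ∧ Uᴴ * U' = 0 ∧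
    Vᴴ * V = 1 ∧ V'ᴴ * V' = 1 ∧ Vᴴ * V' = 0 ∧
    (∀ j, 0 ≤ s' j) ∧ (∀ i j, s' j ≤ s i) ∧ (∀ i, 0 ≤ s i) ∧
    H = U * Matrix.diagonal (fun i => (s i : ℂ)) * Vᴴ +
      U' * Matrix.diagonal (fun j => (s' j : ℂ)) * V'ᴴ

/-- The least-squares solutions `Γ̃_n = (J̆_{n,1} U)† J̆_{n,2} U`, `n = 1, …, 5`. -/
def shiftMat (F Q : ∀ k, Matrix (Fin (N k)) (Fin (N k)) ℂ) {K₅ : ℕ}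
    (U : Matrix (Idx N K₅) (Fin L) ℂ) : Fin 5 → Matrix (Fin L) (Fin L) ℂ :=
  Fin.snoc (α := fun _ => Matrix (Fin L) (Fin L) ℂ)
    (fun k => pinv (J₁ Q K₅ k * U) * (J₂ F Q K₅ k * U))
    (pinv (J₁freq N K₅ * U) * (J₂freq N K₅ * U))

/-- `phat` is a possible output of the matrix-based beamspace ESPRIT algorithm run on the
beamspace observation `h`, with weights `β`: for some choice `U` of the leading left singular
vectors of `𝒮(h)` and some eigendecomposition of `∑ β_n Γ̃_n` with eigenvector matrix `E`, the
estimated angular frequencies `ω̂_{l,n}` are the imaginary parts of the logarithms of the diagonal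
entries of `E⁻¹ Γ̃_n E`, the angles and delays are the parameters in the region that correspond to
them, and the gains are the least-squares estimate `B̂† h`. -/
def IsESPRITOutput (T : ∀ k, Matrix (Fin (M k)) (Fin (N k)) ℂ)
    (F Q : ∀ k, Matrix (Fin (N k)) (Fin (N k)) ℂ) {Δf : ℝ} (R : ParamRegion Δf)
    (K₅ L₅ : ℕ) {M₅ : ℕ} (β : Fin 5 → ℂ) (h : Idx N M₅ → ℂ) (phat : ChannelParams L) : Prop :=
  ∃ (U : Matrix (Idx N K₅) (Fin L) ℂ) (E : Matrix (Fin L) (Fin L) ℂ) (lam : Fin L → ℂ)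
    (ωhat : Fin L → Fin 5 → ℝ),
    IsLeadingLeftSingular (smooth K₅ L₅ h) U ∧
    IsUnit E.det ∧
    ∑ n, β n • shiftMat F Q U n = E * Matrix.diagonal lam * E⁻¹ ∧
    (∀ l n, ωhat l n = (Complex.log ((E⁻¹ * shiftMat F Q U n * E) l l)).im) ∧
    R.Contains phat ∧
    (∀ l, angleFreq (phat.phiAz l, phat.phiEl l) = (ωhat l 0, ωhat l 1)) ∧
    (∀ l, angleFreq (phat.thetaAz l, phat.thetaEl l) = (ωhat l 2, ωhat l 3)) ∧
    (∀ l, phase (-(2 * Real.pi * Δf * phat.tau l)) = phase (ωhat l 4)) ∧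
    phat.gain = pinv (beamMat T ωhat M₅) *ᵥ h

/-! ### The vectors and matrices of the perturbation formulas

Here `ω` are the true angular frequencies and `γ` the true gains. -/

/-- The rows `λ_{l,n}ᴴ = b_lᵀ (J̆_{n,1} P)† (J̆_{n,2} - Φ_{l,n} J̆_{n,1})`. -/
def lamRow (T : ∀ k, Matrix (Fin (M k)) (Fin (N k)) ℂ)
    (F Q : ∀ k, Matrix (Fin (N k)) (Fin (N k)) ℂ) (K₅ : ℕ) (ω : Fin L → Fin 5 → ℝ)
    (l : Fin L) : Fin 5 → Idx N K₅ → ℂ :=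
  Fin.snoc (α := fun _ => Idx N K₅ → ℂ)
    (fun k => (pinv (J₁ Q K₅ k * beamMat T ω K₅) *
      (J₂ F Q K₅ k - phase (ω l k.castSucc) • J₁ Q K₅ k)).row l)
    ((pinv (J₁freq N K₅ * beamMat T ω K₅) *
      (J₂freq N K₅ - phase (ω l (Fin.last 4)) • J₁freq N K₅)).row l)

/-- `χ_l`, defined by `χ_l^* = (Gᵀ)† b_l` with `G = A₅^{(L₅)}`. -/
def chi (L₅ : ℕ) (ω : Fin L → Fin 5 → ℝ) (l : Fin L) (ℓ : Fin L₅) : ℂ :=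
  star (pinv (vander L₅ fun l' => ω l' (Fin.last 4))ᵀ ℓ l)

/-- `ξ_{l,n}`: each block is the convolution of the corresponding block of `λ_{l,n}`
with `χ_l`. -/
def xi (T : ∀ k, Matrix (Fin (M k)) (Fin (N k)) ℂ)
    (F Q : ∀ k, Matrix (Fin (N k)) (Fin (N k)) ℂ) (K₅ L₅ : ℕ) {M₅ : ℕ}
    (ω : Fin L → Fin 5 → ℝ) (l : Fin L) (n : Fin 5) (i : Idx N M₅) : ℂ :=
  ∑ k : Fin K₅, ∑ ℓ : Fin L₅,
    if (k : ℕ) + ℓ = i.2 then star (lamRow T F Q K₅ ω l n (i.1, k)) * chi L₅ ω l ℓ else 0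

/-- `υ_{l,n} = Φ_{l,n} ξ_{l,n} / γ_l^*`. -/
def upsilon (T : ∀ k, Matrix (Fin (M k)) (Fin (N k)) ℂ)
    (F Q : ∀ k, Matrix (Fin (N k)) (Fin (N k)) ℂ) (K₅ L₅ : ℕ) {M₅ : ℕ}
    (ω : Fin L → Fin 5 → ℝ) (γ : Fin L → ℂ) (l : Fin L) (n : Fin 5) : Idx N M₅ → ℂ :=
  fun i => phase (ω l n) * xi T F Q K₅ L₅ ω l n i / star (γ l)

/-- `V_n = [υ_{1,n}, …, υ_{L,n}]`. -/
def upsilonMat (T : ∀ k, Matrix (Fin (M k)) (Fin (N k)) ℂ)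
    (F Q : ∀ k, Matrix (Fin (N k)) (Fin (N k)) ℂ) (K₅ L₅ : ℕ) {M₅ : ℕ}
    (ω : Fin L → Fin 5 → ℝ) (γ : Fin L → ℂ) (n : Fin 5) : Matrix (Idx N M₅) (Fin L) ℂ :=
  Matrix.of fun i l => upsilon T F Q K₅ L₅ ω γ l n i

/-- `Υ_n = B† B̆_n ⊙ γᵀ`. -/
def UpsilonCap (T : ∀ k, Matrix (Fin (M k)) (Fin (N k)) ℂ) (M₅ : ℕ)
    (ω : Fin L → Fin 5 → ℝ) (γ : Fin L → ℂ) (n : Fin 5) : Matrix (Fin L) (Fin L) ℂ :=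
  Matrix.of fun i l => (pinv (beamMat T ω M₅) * derivBeamMat T ω M₅ n) i l * γ l

/-- The azimuth vector
`υ / (π cos az sin el) + sin az cos el υ' / (π cos az sin² el)`. -/
def kappaAz {ι : Type*} (az el : ℝ) (u u' : ι → ℂ) : ι → ℂ :=
  (1 / (Real.pi * Real.cos az * Real.sin el)) • u +
    (Real.sin az * Real.cos el / (Real.pi * Real.cos az * Real.sin el ^ 2)) • u'

/-- The elevation vector `- υ' / (π sin el)`. -/
def kappaEl {ι : Type*} (el : ℝ) (u' : ι → ℂ) : ι → ℂ :=
  (-(1 / (Real.pi * Real.sin el))) • u'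

/-- The delay vector `- υ / (2 π Δf)`. -/
def kappaDelay {ι : Type*} (Δf : ℝ) (u : ι → ℂ) : ι → ℂ :=
  (-(1 / (2 * Real.pi * Δf))) • u

/-- The vectors `κ_{l,1}, …, κ_{l,5}`. -/
def kappa (T : ∀ k, Matrix (Fin (M k)) (Fin (N k)) ℂ)
    (F Q : ∀ k, Matrix (Fin (N k)) (Fin (N k)) ℂ) (K₅ L₅ : ℕ) {M₅ : ℕ} (Δf : ℝ)
    (p : ChannelParams L) (l : Fin L) : Fin 5 → Idx N M₅ → ℂ :=
  let u : Fin 5 → Idx N M₅ → ℂ := upsilon T F Q K₅ L₅ (p.freq Δf) p.gain l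
  ![kappaAz (p.phiAz l) (p.phiEl l) (u 0) (u 1),
    kappaEl (p.phiEl l) (u 1),
    kappaAz (p.thetaAz l) (p.thetaEl l) (u 2) (u 3),
    kappaEl (p.thetaEl l) (u 3),
    kappaDelay Δf (u 4)]

/-- `Im{κᴴ Δh}`. -/
def imPart {ι : Type*} [Fintype ι] (κ Δh : ι → ℂ) : ℝ := (star κ ⬝ᵥ Δh).im

/-- `b_lᵀ B† Δh - ∑ₙ b_lᵀ Υ_n Im{V_nᴴ Δh}`. -/
def gainPerturbation (T : ∀ k, Matrix (Fin (M k)) (Fin (N k)) ℂ)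
    (F Q : ∀ k, Matrix (Fin (N k)) (Fin (N k)) ℂ) (K₅ L₅ : ℕ) {M₅ : ℕ} (Δf : ℝ)
    (p : ChannelParams L) (l : Fin L) (Δh : Idx N M₅ → ℂ) : ℂ :=
  (pinv (beamMat T (p.freq Δf) M₅) *ᵥ Δh) l -
    ∑ n, (UpsilonCap T M₅ (p.freq Δf) p.gain n *ᵥ
      fun l' => ((((upsilonMat T F Q K₅ L₅ (p.freq Δf) p.gain n)ᴴ *ᵥ Δh) l').im : ℂ)) l

end Matrices

end BeamESPRIT

end

/-! Smoothing turns the noiseless channel into `P * K`, where `K = Diag(γ) Gᵀ` has rank `L`, and the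
noise adds `D = smooth Δh`. Singular vectors, eigenvectors and path labels need not depend
continuously on the noise, so nothing is differentiated along them. Each stage is an identity up to
a free change of basis or a permutation, with a negligible remainder.

Subspace. Singular values beyond the `L`-th are `O(‖D‖)`, and orthogonality in the singular value
decomposition gives `R (P K)ᴴ = R Rᴴ - R Dᴴ` for the discarded part `R`, which is of second order.
The right inverse `W` of `K` has its columns in the range of `Kᴴ`, so `R W` is of second order as
well, and `U C = P + D W + O(‖D‖²)` with `C` invertible (`exists_basis_change`).

Phases. Inserted into the shift equations, this makes every `C⁻¹ Γ C` a first-order perturbation of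
a diagonal matrix with explicit diagonal errors (`shift_solution_expansion`). After a permutation
and a scaling, the eigenvector matrix differs from the identity by first-order off-diagonal entries,
and these change the diagonals only to second order (`exists_perm_joint_diagonal`). The estimated
phase is therefore `Φ (1 + υᴴ Δh)` up to `o(‖Δh‖)`, and the imaginary part of its logarithm yields
`Im (υᴴ Δh)` (`log_im_expansion`).

Parameters. The inverse function theorem, with injectivity on the region, converts frequency errors
to angle errors (`angle_expansion`); delays depend linearly on frequency. For the gains, `B̂† (B γ +
Δh) = γ + B̂† (Δh - (B̂ - B) γ)`, where `B̂†` may be replaced by its limit and `B̂ - B` by its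
differential (`leastSquares_expansion`). -/

namespace BeamESPRIT

/-! ### Continuity of matrix products. -/

section MatrixLimits

variable {α l m n : Type*} [Fintype m] {𝓕 : Filter α}

theorem tendsto_matrix_mul {A : α → Matrix l m ℂ} {B : α → Matrix m n ℂ}
    {A₀ : Matrix l m ℂ} {B₀ : Matrix m n ℂ} (hA : Tendsto A 𝓕 (𝓝 A₀)) (hB : Tendsto B 𝓕 (𝓝 B₀)) :
    Tendsto (fun x => A x * B x) 𝓕 (𝓝 (A₀ * B₀)) := by
  refine tendsto_pi_nhds.2 fun i => tendsto_pi_nhds.2 fun j => ?_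
  simp only [Matrix.mul_apply]
  exact tendsto_finsetSum _ fun k _ =>
    ((hA.apply_nhds i).apply_nhds k).mul ((hB.apply_nhds k).apply_nhds j)

end MatrixLimits

theorem tendsto_gram {α m n : Type*} [Fintype m] {𝓕 : Filter α} {A : α → Matrix m n ℂ}
    {A₀ : Matrix m n ℂ} (hA : Tendsto A 𝓕 (𝓝 A₀)) :
    Tendsto (fun x => (A x)ᴴ * A x) 𝓕 (𝓝 (A₀ᴴ * A₀)) :=
  tendsto_matrix_mul ((continuous_id.matrix_conjTranspose.tendsto A₀).comp hA) hA

/-! ### Pseudoinverses of matrices with full column rank. -/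

section PseudoInverse

variable {α m n : Type*} [Fintype m] [Fintype n] {𝓕 : Filter α}

/-- A permutation of columns is a unitary change of variables and so respects all four Penrose
conditions. This carries the relabelling of the paths through the gain estimate. -/
theorem pinv_submatrix_right (A : Matrix m n ℂ) (σ : n ≃ n) :
    pinv (A.submatrix id σ) = (pinv A).submatrix σ id := by
  obtain ⟨h1, h2, h3, h4⟩ := pinv_spec A
  have e (B : Matrix m n ℂ) (X : Matrix n m ℂ) :
      B.submatrix id σ * X.submatrix σ id = B * X := by
    rw [Matrix.submatrix_mul_equiv]; rfl
  have e' (X : Matrix n m ℂ) (B : Matrix m n ℂ) :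
      X.submatrix σ id * B.submatrix id σ = (X * B).submatrix σ σ := rfl
  refine pinv_eq ⟨?_, ?_, ?_, ?_⟩
  · rw [e, ← h1, h1]
    conv_rhs => rw [← h1]
    rfl
  · conv_rhs => rw [← h2]
    rw [e', Matrix.submatrix_mul_equiv]
  · rw [e]; exact h3
  · rw [e']; exact h4.submatrix σ

variable [DecidableEq n]

open scoped ComplexOrder in
-- The Gram matrix has the same rank as `A`. Full column rank is used in this form below because
-- invertibility of a determinant is an open condition.
theorem isUnit_det_gram_of_rank {A : Matrix m n ℂ} (h : A.rank = Fintype.card n) :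
    IsUnit (Aᴴ * A).det := by
  rw [← Matrix.isUnit_iff_isUnit_det, ← Matrix.mulVec_surjective_iff_isUnit]
  have h2 : (Aᴴ * A).rank = Fintype.card n := by rw [Matrix.rank_conjTranspose_mul_self, h]
  have h3 : LinearMap.range (Aᴴ * A).mulVecLin = ⊤ := by
    apply Submodule.eq_top_of_finrank_eq
    rw [Module.finrank_fintype_fun_eq_card]
    exact h2
  exact LinearMap.range_eq_top.1 h3

open scoped ComplexOrder in
theorem isUnit_det_gram_of_left_inverse {A : Matrix m n ℂ} {X : Matrix n m ℂ} (h : X * A = 1) :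
    IsUnit (Aᴴ * A).det := by
  refine isUnit_det_gram_of_rank (le_antisymm A.rank_le_card_width ?_)
  calc Fintype.card n = (X * A).rank := by rw [h, Matrix.rank_one]
    _ ≤ A.rank := Matrix.rank_mul_le_right X A

theorem pinv_eq_of_isUnit {A : Matrix m n ℂ} (h : IsUnit (Aᴴ * A).det) :
    pinv A = (Aᴴ * A)⁻¹ * Aᴴ := by
  have h1 : (Aᴴ * A)⁻¹ * Aᴴ * A = 1 := by
    rw [Matrix.mul_assoc, Matrix.nonsing_inv_mul _ h]
  refine pinv_eq ⟨?_, ?_, ?_, ?_⟩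
  · rw [Matrix.mul_assoc, h1, Matrix.mul_one]
  · rw [h1, Matrix.one_mul]
  · simp only [Matrix.IsHermitian, Matrix.conjTranspose_mul, Matrix.conjTranspose_conjTranspose,
      Matrix.conjTranspose_nonsing_inv, Matrix.mul_assoc]
  · rw [h1]; exact Matrix.isHermitian_one

theorem pinv_mul_self {A : Matrix m n ℂ} (h : IsUnit (Aᴴ * A).det) : pinv A * A = 1 := by
  rw [pinv_eq_of_isUnit h, Matrix.mul_assoc, Matrix.nonsing_inv_mul _ h]

/-- The reversal rule fails for general pseudoinverses. Here `A` and `A * C` have the same range,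
hence the same orthogonal projector, and both have a left inverse. It serves to strip the unknown
change of basis from the least-squares solutions. -/
theorem pinv_mul_of_isUnit {A : Matrix m n ℂ} (h : IsUnit (Aᴴ * A).det) {C : Matrix n n ℂ}
    (hC : IsUnit C.det) : pinv (A * C) = C⁻¹ * pinv A := by
  obtain ⟨h1, h2, h3, h4⟩ := pinv_spec A
  have hA := pinv_mul_self h
  have e : A * C * (C⁻¹ * pinv A) = A * pinv A := by
    rw [Matrix.mul_assoc, ← Matrix.mul_assoc C, Matrix.mul_nonsing_inv _ hC, Matrix.one_mul]
  have e' : C⁻¹ * pinv A * (A * C) = 1 := by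
    rw [Matrix.mul_assoc, ← Matrix.mul_assoc (pinv A), hA, Matrix.one_mul,
      Matrix.nonsing_inv_mul _ hC]
  refine pinv_eq ⟨?_, ?_, ?_, ?_⟩
  · rw [e, ← Matrix.mul_assoc, h1]
  · rw [e', Matrix.one_mul]
  · rw [e]; exact h3
  · rw [e']; exact Matrix.isHermitian_one

theorem eventually_isUnit_det {A : α → Matrix n n ℂ} {A₀ : Matrix n n ℂ}
    (h : IsUnit A₀.det) (hA : Tendsto A 𝓕 (𝓝 A₀)) : ∀ᶠ x in 𝓕, IsUnit (A x).det := by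
  have h1 : Tendsto (fun x => (A x).det) 𝓕 (𝓝 A₀.det) :=
    (continuous_id.matrix_det.tendsto A₀).comp hA
  filter_upwards [h1.eventually_ne h.ne_zero] with x hx using isUnit_iff_ne_zero.2 hx

/-- The pseudoinverse jumps where the rank drops; near a matrix of full column rank the Gram formula
persists and is continuous. -/
theorem tendsto_pinv {A : α → Matrix m n ℂ} {A₀ : Matrix m n ℂ} (h : IsUnit (A₀ᴴ * A₀).det)
    (hA : Tendsto A 𝓕 (𝓝 A₀)) : Tendsto (fun x => pinv (A x)) 𝓕 (𝓝 (pinv A₀)) := by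
  have h1 : Tendsto (fun x => ((A x)ᴴ * A x)⁻¹ * (A x)ᴴ) 𝓕 (𝓝 ((A₀ᴴ * A₀)⁻¹ * A₀ᴴ)) := by
    refine tendsto_matrix_mul ?_ ((continuous_id.matrix_conjTranspose.tendsto A₀).comp hA)
    refine Tendsto.comp (continuousAt_matrix_inv _ ?_) (tendsto_gram hA)
    rw [Ring.inverse_eq_inv']
    exact continuousAt_inv₀ h.ne_zero
  rw [pinv_eq_of_isUnit h]
  refine h1.congr' ?_
  filter_upwards [eventually_isUnit_det h (tendsto_gram hA)] with x hx
  rw [pinv_eq_of_isUnit hx]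

end PseudoInverse

attribute [local instance] Matrix.normedAddCommGroup Matrix.normedSpace

/-! ### Asymptotic calculus for matrices in the entrywise sup norm. -/

section MatrixAsymptotics

variable {α l m n : Type*} [Fintype l] [Fintype m] [Fintype n] {𝓕 : Filter α}

/-- The sup norm of entries is not submultiplicative; the inner dimension is the price, and it
disappears in `O` and `o` estimates. -/
theorem norm_matrix_mul_le (A : Matrix l m ℂ) (B : Matrix m n ℂ) :
    ‖A * B‖ ≤ Fintype.card m * (‖A‖ * ‖B‖) := by
  refine (Matrix.norm_le_iff (by positivity)).2 fun i j => ?_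
  rw [Matrix.mul_apply]
  refine (norm_sum_le _ _).trans ?_
  calc ∑ k, ‖A i k * B k j‖ ≤ ∑ _k : m, ‖A‖ * ‖B‖ := by
        refine Finset.sum_le_sum fun k _ => ?_
        rw [norm_mul]
        gcongr
        · exact Matrix.norm_entry_le_entrywise_sup_norm A
        · exact Matrix.norm_entry_le_entrywise_sup_norm B
    _ = _ := by simp

theorem isBigO_matrix_mul {A : α → Matrix l m ℂ} {B : α → Matrix m n ℂ} {f g : α → ℝ}
    (hA : A =O[𝓕] f) (hB : B =O[𝓕] g) : (fun x => A x * B x) =O[𝓕] fun x => f x * g x := by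
  have h : (fun x => A x * B x) =O[𝓕] fun x => ‖A x‖ * ‖B x‖ :=
    IsBigO.of_bound (Fintype.card m) (Eventually.of_forall fun x => by
      simpa using norm_matrix_mul_le (A x) (B x))
  exact h.trans (hA.norm_left.mul hB.norm_left)

theorem isBigO_matrix_mul_const {A : α → Matrix l m ℂ} {f : α → ℝ}
    (hA : A =O[𝓕] f) (B : Matrix m n ℂ) : (fun x => A x * B) =O[𝓕] f := by
  simpa using isBigO_matrix_mul hA (isBigO_const_const B (one_ne_zero (α := ℝ)) 𝓕)

theorem isBigO_const_matrix_mul (A : Matrix l m ℂ) {B : α → Matrix m n ℂ} {f : α → ℝ}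
    (hB : B =O[𝓕] f) : (fun x => A * B x) =O[𝓕] f := by
  simpa using isBigO_matrix_mul (isBigO_const_const A (one_ne_zero (α := ℝ)) 𝓕) hB

theorem isLittleO_matrix_mul {A : α → Matrix l m ℂ} {B : α → Matrix m n ℂ} {f : α → ℝ}
    (hA : Tendsto A 𝓕 (𝓝 0)) (hB : B =O[𝓕] f) : (fun x => A x * B x) =o[𝓕] f := by
  have h : (fun x => A x * B x) =O[𝓕] fun x => ‖A x‖ * ‖B x‖ :=
    IsBigO.of_bound (Fintype.card m) (Eventually.of_forall fun x => by
      simpa using norm_matrix_mul_le (A x) (B x))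
  refine h.trans_isLittleO ?_
  simpa using ((isLittleO_one_iff ℝ).2 (tendsto_zero_iff_norm_tendsto_zero.1 hA)).mul_isBigO
    hB.norm_left

theorem isBigO_conjTranspose {A : α → Matrix m n ℂ} {f : α → ℝ} (hA : A =O[𝓕] f) :
    (fun x => (A x)ᴴ) =O[𝓕] f := by
  refine IsBigO.trans (IsBigO.of_bound 1 (Eventually.of_forall fun x => ?_)) hA
  simp [Matrix.norm_conjTranspose]

theorem isBigO_entry {A : α → Matrix m n ℂ} {f : α → ℝ} (hA : A =O[𝓕] f) (i : m) (j : n) :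
    (fun x => A x i j) =O[𝓕] f :=
  (IsBigO.of_bound 1 (Eventually.of_forall fun x => by
    simpa using Matrix.norm_entry_le_entrywise_sup_norm (A x))).trans hA

theorem isLittleO_entry {A : α → Matrix m n ℂ} {f : α → ℝ} (hA : A =o[𝓕] f) (i : m) (j : n) :
    (fun x => A x i j) =o[𝓕] f :=
  (IsBigO.of_bound 1 (Eventually.of_forall fun x => by
    simpa using Matrix.norm_entry_le_entrywise_sup_norm (A x))).trans_isLittleO hA

end MatrixAsymptotics

/-! ### Perturbation of the leading singular subspace. -/

section SingularSubspace

variable {m n c : Type*} [Fintype m] [Fintype n] [Fintype c]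

theorem ofReal_sum_norm_sq (v : n → ℂ) : ((∑ i, ‖v i‖ ^ 2 : ℝ) : ℂ) = star v ⬝ᵥ v := by
  simp only [dotProduct, Pi.star_apply, Complex.star_def, Complex.conj_mul', Complex.ofReal_sum,
    Complex.ofReal_pow]

theorem sum_norm_sq_mulVec_of_isometry [DecidableEq n] {U : Matrix m n ℂ} (hU : Uᴴ * U = 1)
    (v : n → ℂ) : ∑ i, ‖(U *ᵥ v) i‖ ^ 2 = ∑ j, ‖v j‖ ^ 2 := by
  have h : star (U *ᵥ v) ⬝ᵥ (U *ᵥ v) = star v ⬝ᵥ v := by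
    rw [Matrix.star_mulVec, Matrix.dotProduct_mulVec, Matrix.vecMul_vecMul, hU, Matrix.vecMul_one]
  rw [← ofReal_sum_norm_sq, ← ofReal_sum_norm_sq] at h
  exact_mod_cast h

theorem norm_entry_le_one_of_isometry [DecidableEq n] {U : Matrix m n ℂ} (hU : Uᴴ * U = 1)
    (i : m) (j : n) : ‖U i j‖ ≤ 1 := by
  have h := sum_norm_sq_mulVec_of_isometry hU (Pi.single j 1)
  have h1 : ∑ k, ‖(Pi.single j 1 : n → ℂ) k‖ ^ 2 = 1 := by
    rw [Finset.sum_eq_single j] <;> simp +contextual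
  rw [h1] at h
  have h2 : ‖(U *ᵥ Pi.single j 1) i‖ ^ 2 ≤ 1 := by
    rw [← h]
    exact Finset.single_le_sum (f := fun i => ‖(U *ᵥ Pi.single j 1) i‖ ^ 2)
      (fun _ _ => sq_nonneg _) (Finset.mem_univ i)
  rw [Matrix.mulVec_single_one] at h2
  exact (sq_le_one_iff₀ (norm_nonneg _)).1 h2

theorem sum_norm_sq_mulVec_le (D : Matrix m n ℂ) (v : n → ℂ) :
    ∑ i, ‖(D *ᵥ v) i‖ ^ 2 ≤
      Fintype.card m * (Fintype.card n * ‖D‖ ^ 2 * ∑ j, ‖v j‖ ^ 2) := by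
  have h : ∀ i, ‖(D *ᵥ v) i‖ ^ 2 ≤ Fintype.card n * ‖D‖ ^ 2 * ∑ j, ‖v j‖ ^ 2 := by
    intro i
    have h1 : ‖(D *ᵥ v) i‖ ≤ ∑ j, ‖D‖ * ‖v j‖ := by
      refine (norm_sum_le _ _).trans (Finset.sum_le_sum fun j _ => ?_)
      rw [norm_mul]
      gcongr
      exact Matrix.norm_entry_le_entrywise_sup_norm D
    calc ‖(D *ᵥ v) i‖ ^ 2 ≤ (∑ j, ‖D‖ * ‖v j‖) ^ 2 := by gcongr
      _ ≤ Fintype.card n * ∑ j, (‖D‖ * ‖v j‖) ^ 2 := by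
          simpa using sq_sum_le_card_mul_sum_sq (s := Finset.univ) (f := fun j => ‖D‖ * ‖v j‖)
      _ = _ := by simp only [mul_pow, ← Finset.mul_sum]; ring
  calc _ ≤ ∑ _i : m, Fintype.card n * ‖D‖ ^ 2 * ∑ j, ‖v j‖ ^ 2 := Finset.sum_le_sum fun i _ => h i
    _ = _ := by simp

/-- A singular value that is dominated by `L` others is at most as large as the distance to the
matrices of rank at most `L`, up to a dimensional constant. -/
theorem singularValue_le {L d : ℕ} {H D : Matrix m c ℂ} {P : Matrix m (Fin L) ℂ}
    {K : Matrix (Fin L) c ℂ} (hH : H = P * K + D)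
    {W : Matrix m (Fin L ⊕ Fin d) ℂ} {V : Matrix c (Fin L ⊕ Fin d) ℂ} {t : Fin L ⊕ Fin d → ℝ}
    (hW : Wᴴ * W = 1) (hV : Vᴴ * V = 1) (hsvd : H = W * Matrix.diagonal (fun i => (t i : ℂ)) * Vᴴ)
    {k : Fin d} (hk : 0 ≤ t (Sum.inr k)) (hle : ∀ i, t (Sum.inr k) ≤ t (Sum.inl i)) :
    t (Sum.inr k) ≤ Fintype.card m * Fintype.card c * ‖D‖ := by
  -- Select the `L` leading singular pairs and the `k`-th trailing one: `L + 1` directions, one more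
  -- than the rank of `P * K` can be.
  let ι : (Fin L ⊕ Unit) → Fin L ⊕ Fin d := Sum.map id fun _ => k
  have hι : Function.Injective ι := by
    refine Function.Injective.sumMap Function.injective_id fun _ _ _ => rfl
  let V' := V.submatrix id ι
  let W' := W.submatrix id ι
  have hV' : V'ᴴ * V' = 1 := by
    have : V'ᴴ * V' = (Vᴴ * V).submatrix ι ι := rfl
    rw [this, hV, Matrix.submatrix_one _ hι]
  have hW' : W'ᴴ * W' = 1 := by
    have : W'ᴴ * W' = (Wᴴ * W).submatrix ι ι := rfl
    rw [this, hW, Matrix.submatrix_one _ hι]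
  have hHV : H * V' = W' * Matrix.diagonal (fun i => (t (ι i) : ℂ)) := by
    have h1 : H * V = W * Matrix.diagonal (fun i => (t i : ℂ)) := by
      rw [hsvd, Matrix.mul_assoc _ Vᴴ, hV, Matrix.mul_one]
    have h2 : H * V' = (H * V).submatrix id ι := rfl
    rw [h2, h1]
    ext i j
    simp [W', Matrix.mul_diagonal]
  -- `K * V'` has `L` rows and `L + 1` columns, hence a kernel. On the vector found there `H` acts
  -- as `D`, yet it stretches by at least the smallest selected singular value.
  obtain ⟨y, hy, hy0⟩ : ∃ y, (K * V') *ᵥ y = 0 ∧ y ≠ 0 := by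
    have hker : LinearMap.ker (K * V').mulVecLin ≠ ⊥ := by
      apply LinearMap.ker_ne_bot_of_finrank_lt
      simp
    obtain ⟨y, hy, hy0⟩ := Submodule.exists_mem_ne_zero_of_ne_bot hker
    exact ⟨y, hy, hy0⟩
  set s : ℝ := ∑ j, ‖y j‖ ^ 2 with hs
  have hs0 : 0 < s := by
    obtain ⟨j, hj⟩ := Function.ne_iff.1 hy0
    refine Finset.sum_pos' (fun _ _ => sq_nonneg _) ⟨j, Finset.mem_univ j, ?_⟩
    have : 0 < ‖y j‖ := norm_pos_iff.2 hj
    positivity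
  have e1 : W' *ᵥ (Matrix.diagonal (fun i => (t (ι i) : ℂ)) *ᵥ y) = D *ᵥ (V' *ᵥ y) := by
    rw [Matrix.mulVec_mulVec, ← hHV, hH, Matrix.add_mul, Matrix.add_mulVec, Matrix.mul_assoc,
      ← Matrix.mulVec_mulVec _ P, hy, Matrix.mulVec_zero, zero_add, Matrix.mulVec_mulVec]
  have e2 : t (Sum.inr k) ^ 2 * s ≤ ∑ j, ‖(D *ᵥ (V' *ᵥ y)) j‖ ^ 2 := by
    rw [← e1, sum_norm_sq_mulVec_of_isometry hW', hs, Finset.mul_sum]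
    refine Finset.sum_le_sum fun j _ => ?_
    rw [Matrix.mulVec_diagonal, norm_mul, mul_pow, Complex.norm_real, Real.norm_eq_abs, sq_abs]
    gcongr
    rcases j with j | j
    · exact hle j
    · exact le_rfl
  have e3 := e2.trans (sum_norm_sq_mulVec_le D (V' *ᵥ y))
  rw [sum_norm_sq_mulVec_of_isometry hV', ← hs] at e3
  have e4 : t (Sum.inr k) ^ 2 ≤ Fintype.card m * (Fintype.card c * ‖D‖ ^ 2) := by
    refine le_of_mul_le_mul_right (e3.trans_eq ?_) hs0
    ring
  -- Enlarging the dimensions to their squares keeps square roots out of the constant.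
  have hn : ∀ a : ℕ, (a : ℝ) ≤ (a : ℝ) ^ 2 := fun a => by exact_mod_cast Nat.le_self_pow two_ne_zero a
  refine le_of_sq_le_sq (e4.trans ?_) (by positivity)
  calc (Fintype.card m : ℝ) * (Fintype.card c * ‖D‖ ^ 2)
      ≤ (Fintype.card m : ℝ) ^ 2 * ((Fintype.card c : ℝ) ^ 2 * ‖D‖ ^ 2) := by
        gcongr <;> exact hn _
    _ = _ := by ring

theorem fromCols_isometry {a b : Type*} [Fintype a] [Fintype b] [DecidableEq a] [DecidableEq b]
    {A : Matrix m a ℂ} {B : Matrix m b ℂ} (hA : Aᴴ * A = 1) (hB : Bᴴ * B = 1) (hAB : Aᴴ * B = 0) :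
    (A.fromCols B)ᴴ * A.fromCols B = 1 := by
  have hBA : Bᴴ * A = 0 := by
    rw [← Matrix.conjTranspose_conjTranspose (Bᴴ * A), Matrix.conjTranspose_mul,
      Matrix.conjTranspose_conjTranspose, hAB, Matrix.conjTranspose_zero]
  rw [Matrix.conjTranspose_fromCols_eq_fromRows_conjTranspose, Matrix.fromRows_mul_fromCols,
    hA, hB, hAB, hBA, Matrix.fromBlocks_one]

/-- What the leading left singular vectors `U` of `H` miss, for `H` at distance `D` from the
matrices of rank at most `L`. -/
theorem IsLeadingLeftSingular.residual {L : ℕ} {H D : Matrix m c ℂ} {P : Matrix m (Fin L) ℂ}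
    {K : Matrix (Fin L) c ℂ} (hH : H = P * K + D) {U : Matrix m (Fin L) ℂ}
    (hU : IsLeadingLeftSingular H U) :
    ∃ R : Matrix m c ℂ, H = U * (Uᴴ * H) + R ∧ R * Hᴴ = R * Rᴴ ∧
      ‖R‖ ≤ (Fintype.card m) ^ 2 * Fintype.card c * ‖D‖ := by
  obtain ⟨V, s, d, U', V', s', h1, h2, h3, h4, h5, h6, h7, h8, -, h10⟩ := hU
  have hdiag : H = U.fromCols U' * Matrix.diagonal (fun i => ((Sum.elim s s' i : ℝ) : ℂ)) *
      (V.fromCols V')ᴴ := by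
    have e : (Matrix.diagonal (fun i => ((Sum.elim s s' i : ℝ) : ℂ))) =
        Matrix.fromBlocks (Matrix.diagonal fun i => (s i : ℂ)) 0 0
          (Matrix.diagonal fun i => (s' i : ℂ)) := by
      rw [Matrix.fromBlocks_diagonal]
      congr 1
      funext i
      rcases i with i | i <;> rfl
    rw [e, Matrix.fromCols_mul_fromBlocks, Matrix.conjTranspose_fromCols_eq_fromRows_conjTranspose,
      Matrix.fromCols_mul_fromRows]
    simpa using h10
  have hs' : ∀ k, s' k ≤ Fintype.card m * Fintype.card c * ‖D‖ := fun k =>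
    singularValue_le (t := Sum.elim s s') hH (fromCols_isometry h1 h2 h3) (fromCols_isometry h4 h5 h6) hdiag
      (h7 k) (fun i => h8 i k)
  have hUH : Uᴴ * H = Matrix.diagonal (fun i => (s i : ℂ)) * Vᴴ := by
    rw [h10, Matrix.mul_add, Matrix.mul_assoc U', ← Matrix.mul_assoc Uᴴ U', h3, Matrix.zero_mul,
      add_zero, Matrix.mul_assoc U, ← Matrix.mul_assoc Uᴴ U, h1, Matrix.one_mul]
  -- The residual is the trailing part of the decomposition. Orthogonality of the right singular
  -- vectors removes the cross term in `R * Hᴴ`.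
  refine ⟨U' * Matrix.diagonal (fun j => (s' j : ℂ)) * V'ᴴ, ?_, ?_, ?_⟩
  · rw [hUH, ← Matrix.mul_assoc]; exact h10
  · have a4 : V'ᴴ * V = 0 := by
      rw [← Matrix.conjTranspose_conjTranspose (V'ᴴ * V), Matrix.conjTranspose_mul,
        Matrix.conjTranspose_conjTranspose, h6, Matrix.conjTranspose_zero]
    conv_lhs => rw [h10]
    rw [Matrix.conjTranspose_add, Matrix.mul_add]
    have : U' * Matrix.diagonal (fun j => (s' j : ℂ)) * V'ᴴ *
        (U * Matrix.diagonal (fun i => (s i : ℂ)) * Vᴴ)ᴴ = 0 := by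
      rw [Matrix.conjTranspose_mul, Matrix.conjTranspose_conjTranspose, Matrix.mul_assoc _ V'ᴴ,
        ← Matrix.mul_assoc V'ᴴ, a4, Matrix.zero_mul, Matrix.mul_zero]
    rw [this, zero_add]
  -- Bounding the number of trailing terms makes the constant independent of the decomposition
  -- chosen.
  · have hd : d ≤ Fintype.card m := by
      calc d = (U'ᴴ * U').rank := by rw [h2, Matrix.rank_one, Fintype.card_fin]
        _ ≤ U'.rank := Matrix.rank_mul_le_right _ _
        _ ≤ Fintype.card m := U'.rank_le_card_height
    refine (Matrix.norm_le_iff (by positivity)).2 fun i j => ?_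
    rw [Matrix.mul_apply]
    refine (norm_sum_le _ _).trans ?_
    calc ∑ k, ‖(U' * Matrix.diagonal (fun j => (s' j : ℂ))) i k * V'ᴴ k j‖
        ≤ ∑ _k : Fin d, 1 * (Fintype.card m * Fintype.card c * ‖D‖) * 1 := by
          refine Finset.sum_le_sum fun k _ => ?_
          rw [Matrix.mul_diagonal, norm_mul, norm_mul, Complex.norm_real, Real.norm_eq_abs,
            abs_of_nonneg (h7 k), Matrix.conjTranspose_apply, norm_star]
          gcongr
          · exact h7 k
          · exact norm_entry_le_one_of_isometry h2 i k
          · exact hs' k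
          · exact norm_entry_le_one_of_isometry h5 j k
      _ = d * (Fintype.card m * Fintype.card c * ‖D‖) := by simp
      _ ≤ Fintype.card m * (Fintype.card m * Fintype.card c * ‖D‖) := by gcongr
      _ = _ := by ring

/-- First-order perturbation of the signal subspace: up to a change of basis, the leading left
singular vectors of `P K + D` are `P + D W + O(‖D‖²)`, with `W` a right inverse of `K` whose
columns lie in the row space of `K`. -/
theorem exists_basis_change {α : Type*} {𝓕 : Filter α} {r : α → ℝ} (hr : Tendsto r 𝓕 (𝓝 0))
    {L : ℕ} {P X : Matrix m (Fin L) ℂ} {K : Matrix (Fin L) c ℂ}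
    {W : Matrix c (Fin L) ℂ} {Z : Matrix (Fin L) (Fin L) ℂ} (hP : Xᴴ * P = 1) (hKW : K * W = 1)
    (hW : W = Kᴴ * Z) {D : α → Matrix m c ℂ} (hD : D =O[𝓕] r)
    {U : α → Matrix m (Fin L) ℂ} (hU : ∀ᶠ x in 𝓕, IsLeadingLeftSingular (P * K + D x) (U x)) :
    ∃ (C : α → Matrix (Fin L) (Fin L) ℂ) (S : α → Matrix m (Fin L) ℂ),
      S =O[𝓕] (fun x => r x * r x) ∧
      ∀ᶠ x in 𝓕, IsUnit (C x).det ∧ U x * C x = P + D x * W + S x := by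
  -- The hypothesis on `U` holds only eventually; elsewhere `R = 0` is a dummy value that makes the
  -- choice total.
  have hres : ∀ x, ∃ R : Matrix m c ℂ, IsLeadingLeftSingular (P * K + D x) (U x) →
      (P * K + D x = U x * ((U x)ᴴ * (P * K + D x)) + R ∧ R * (P * K + D x)ᴴ = R * Rᴴ ∧
      ‖R‖ ≤ (Fintype.card m) ^ 2 * Fintype.card c * ‖D x‖) := fun x => by
    by_cases h : IsLeadingLeftSingular (P * K + D x) (U x)
    · obtain ⟨R, hR⟩ := h.residual rfl
      exact ⟨R, fun _ => hR⟩
    · exact ⟨0, fun h' => (h h').elim⟩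
  choose R hR using hres
  have hRO : R =O[𝓕] r := by
    refine IsBigO.trans (IsBigO.of_bound ((Fintype.card m) ^ 2 * Fintype.card c) ?_) hD
    filter_upwards [hU] with x hx using (hR x hx).2.2
  -- The decisive cancellation: `W = (P K)ᴴ (X Z)`, and `R (P K)ᴴ = R Rᴴ - R Dᴴ` has two first-order
  -- factors in each term.
  have hRW : (fun x => R x * W) =O[𝓕] fun x => r x * r x := by
    have e : ∀ᶠ x in 𝓕, (R x * (R x)ᴴ - R x * (D x)ᴴ) * (X * Z) = R x * W := by
      filter_upwards [hU] with x hx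
      have h1 : R x * (P * K)ᴴ = R x * (R x)ᴴ - R x * (D x)ᴴ := by
        rw [← (hR x hx).2.1, Matrix.conjTranspose_add, Matrix.mul_add]
        abel
      have h2 : W = (P * K)ᴴ * (X * Z) := by
        have : Pᴴ * X = 1 := by
          rw [← Matrix.conjTranspose_conjTranspose (Pᴴ * X), Matrix.conjTranspose_mul,
            Matrix.conjTranspose_conjTranspose, hP, Matrix.conjTranspose_one]
        rw [Matrix.conjTranspose_mul, Matrix.mul_assoc, ← Matrix.mul_assoc Pᴴ, this,
          Matrix.one_mul, hW]
      rw [← h1, Matrix.mul_assoc, ← h2]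
    refine (isBigO_matrix_mul_const ?_ (X * Z)).congr' e EventuallyEq.rfl
    exact (isBigO_matrix_mul hRO (isBigO_conjTranspose hRO)).sub
      (isBigO_matrix_mul hRO (isBigO_conjTranspose hD))
  have hUC : ∀ᶠ x in 𝓕, U x * ((U x)ᴴ * (P * K + D x) * W) = P + D x * W + -(R x * W) := by
    filter_upwards [hU] with x hx
    have h1 : (P * K + D x) * W = P + D x * W := by
      rw [Matrix.add_mul, Matrix.mul_assoc, hKW, Matrix.mul_one]
    have h2 := (hR x hx).1
    calc U x * ((U x)ᴴ * (P * K + D x) * W)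
        = (P * K + D x - R x) * W := by
          conv_rhs => rw [h2]
          rw [add_sub_cancel_right]
          simp only [Matrix.mul_assoc]
      _ = _ := by rw [Matrix.sub_mul, h1, sub_eq_add_neg]
  refine ⟨fun x => (U x)ᴴ * (P * K + D x) * W, fun x => -(R x * W), hRW.neg_left, ?_⟩
  -- Since `Xᴴ U C` tends to the identity, `C` is eventually invertible, although neither `U` nor
  -- `C` need converge.
  have hlim : Tendsto (fun x => Xᴴ * (P + D x * W + -(R x * W))) 𝓕 (𝓝 1) := by
    have h0 : Tendsto (fun x => D x * W + -(R x * W)) 𝓕 (𝓝 0) :=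
      ((isBigO_matrix_mul_const hD W).add (isBigO_matrix_mul_const hRO W).neg_left).trans_tendsto hr
    have h1 := (tendsto_matrix_mul (tendsto_const_nhds (x := Xᴴ)) h0).const_add (1 : Matrix (Fin L) (Fin L) ℂ)
    rw [Matrix.mul_zero, add_zero] at h1
    refine h1.congr fun x => ?_
    rw [add_assoc, Matrix.mul_add Xᴴ P, hP]
  filter_upwards [hUC, eventually_isUnit_det (by simp) hlim] with x hx hx'
  refine ⟨?_, hx⟩
  rw [← hx, ← Matrix.mul_assoc, Matrix.det_mul] at hx'
  exact isUnit_of_mul_isUnit_right hx'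

end SingularSubspace

/-! ### Eigenvectors near a diagonal matrix with distinct entries. -/

section Eigenvectors

variable {L : ℕ}

/-- An eigenvector of a small perturbation of a diagonal matrix with separated entries has one
dominant entry. -/
theorem exists_dominant_entry {A : Matrix (Fin L) (Fin L) ℂ} {d v : Fin L → ℂ} {μ : ℂ} {g ε : ℝ}
    (hg : 0 < g) (hgap : ∀ i j, i ≠ j → g ≤ ‖d i - d j‖) (hε : ‖A - Matrix.diagonal d‖ ≤ ε)
    (hsmall : 2 * (L * ε) ≤ g) (hv : v ≠ 0) (hAv : A *ᵥ v = μ • v) :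
    ∃ l, v l ≠ 0 ∧ ‖μ - d l‖ ≤ L * ε ∧ ∀ i, i ≠ l → ‖v i‖ ≤ 2 * (L * ε) / g * ‖v l‖ := by
  obtain ⟨i₀, hi₀⟩ := Function.ne_iff.1 hv
  have : Nonempty (Fin L) := ⟨i₀⟩
  -- With `v l` of largest modulus, each row of `(A - diagonal d) v` is at most `L ε ‖v l‖`. Row `l`
  -- locates `μ` near `d l`, and the gap then makes the other entries small.
  obtain ⟨l, hl⟩ := Finite.exists_max fun i => ‖v i‖
  have hl0 : 0 < ‖v l‖ := (norm_pos_iff.2 hi₀).trans_le (hl i₀)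
  have key : ∀ i, ‖μ - d i‖ * ‖v i‖ ≤ L * ε * ‖v l‖ := by
    intro i
    have e : (μ - d i) * v i = ∑ k, (A - Matrix.diagonal d) i k * v k := by
      have h1 := congrFun hAv i
      have h2 : ((A - Matrix.diagonal d) *ᵥ v) i = (μ - d i) * v i := by
        rw [Matrix.sub_mulVec, Pi.sub_apply, h1, Matrix.mulVec_diagonal, Pi.smul_apply, smul_eq_mul]
        ring
      rw [← h2]; rfl
    rw [← norm_mul, e]
    refine (norm_sum_le _ _).trans ?_
    calc ∑ k, ‖(A - Matrix.diagonal d) i k * v k‖ ≤ ∑ _k : Fin L, ε * ‖v l‖ := by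
          refine Finset.sum_le_sum fun k _ => ?_
          rw [norm_mul]
          exact mul_le_mul ((Matrix.norm_entry_le_entrywise_sup_norm _).trans hε) (hl k)
            (norm_nonneg _) ((norm_nonneg _).trans hε)
      _ = L * ε * ‖v l‖ := by simp [mul_assoc]
  have hμ : ‖μ - d l‖ ≤ L * ε := le_of_mul_le_mul_right (key l) hl0
  refine ⟨l, norm_pos_iff.1 hl0, hμ, fun i hi => ?_⟩
  have h1 : g / 2 ≤ ‖μ - d i‖ := by
    have h2 : ‖d i - d l‖ ≤ ‖μ - d l‖ + ‖μ - d i‖ := by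
      have : d i - d l = (μ - d l) - (μ - d i) := by ring
      rw [this]; exact norm_sub_le _ _
    have := hgap i l hi
    linarith
  have h3 : g / 2 * ‖v i‖ ≤ L * ε * ‖v l‖ :=
    (mul_le_mul_of_nonneg_right h1 (norm_nonneg _)).trans (key i)
  rw [div_mul_eq_mul_div, le_div_iff₀ hg]
  linarith

/-- Column `j` of `E` and row `j` of `E⁻¹` are right and left eigenvectors for one eigenvalue, so
both peak at the index whose `d` is nearest to it. Two columns cannot peak at the same index: in the
vanishing product of row `j` and column `j'` the dominant term would be too large for the others to
cancel. -/
theorem exists_perm_dominant {A E : Matrix (Fin L) (Fin L) ℂ} {d lam : Fin L → ℂ} {g ε : ℝ}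
    (hg : 0 < g) (hgap : ∀ i j, i ≠ j → g ≤ ‖d i - d j‖) (hε : ‖A - Matrix.diagonal d‖ ≤ ε)
    (hsmall : 4 * (L + 1) * (L * ε) ≤ g) (hE : IsUnit E.det)
    (hA : A = E * Matrix.diagonal lam * E⁻¹) :
    ∃ σ : Equiv.Perm (Fin L), ∀ l, E l (σ l) ≠ 0 ∧ E⁻¹ (σ l) l ≠ 0 ∧ ∀ i, i ≠ l →
      ‖E i (σ l)‖ ≤ 2 * (L * ε) / g * ‖E l (σ l)‖ ∧
      ‖E⁻¹ (σ l) i‖ ≤ 2 * (L * ε) / g * ‖E⁻¹ (σ l) l‖ := by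
  have hLε : 0 ≤ L * ε := mul_nonneg (Nat.cast_nonneg _) ((norm_nonneg _).trans hε)
  have hL : (0 : ℝ) ≤ L := Nat.cast_nonneg _
  have hs2 : 4 * (L * ε) ≤ g := by nlinarith
  have hAE : A * E = E * Matrix.diagonal lam := by
    rw [hA, Matrix.mul_assoc, Matrix.nonsing_inv_mul _ hE, Matrix.mul_one]
  have hEA : E⁻¹ * A = Matrix.diagonal lam * E⁻¹ := by
    rw [hA, ← Matrix.mul_assoc, ← Matrix.mul_assoc, Matrix.nonsing_inv_mul _ hE, Matrix.one_mul]
  have hFE : E⁻¹ * E = 1 := Matrix.nonsing_inv_mul _ hE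
  have hcol : ∀ j, ∃ l, E l j ≠ 0 ∧ ‖lam j - d l‖ ≤ L * ε ∧
      ∀ i, i ≠ l → ‖E i j‖ ≤ 2 * (L * ε) / g * ‖E l j‖ := by
    intro j
    refine exists_dominant_entry (v := fun i => E i j) hg hgap hε (by linarith) ?_ ?_
    · intro h
      have h1 := congrFun (congrFun hFE j) j
      rw [Matrix.mul_apply, Matrix.one_apply_eq] at h1
      simp [fun i => show E i j = 0 from congrFun h i] at h1
    · funext i
      have h1 := congrFun (congrFun hAE i) j
      rw [Matrix.mul_diagonal, mul_comm] at h1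
      exact h1
  have hrow : ∀ j, ∃ l, E⁻¹ j l ≠ 0 ∧ ‖lam j - d l‖ ≤ L * ε ∧
      ∀ i, i ≠ l → ‖E⁻¹ j i‖ ≤ 2 * (L * ε) / g * ‖E⁻¹ j l‖ := by
    intro j
    refine exists_dominant_entry (A := Aᵀ) (v := fun i => E⁻¹ j i) hg hgap ?_ (by linarith) ?_ ?_
    · have : Aᵀ - Matrix.diagonal d = (A - Matrix.diagonal d)ᵀ := by
        rw [Matrix.transpose_sub, Matrix.diagonal_transpose]
      rw [this, Matrix.norm_transpose]
      exact hε
    · intro h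
      have h1 := congrFun (congrFun hFE j) j
      rw [Matrix.mul_apply, Matrix.one_apply_eq] at h1
      simp [fun i => show E⁻¹ j i = 0 from congrFun h i] at h1
    · rw [Matrix.mulVec_transpose]
      funext i
      have h1 := congrFun (congrFun hEA j) i
      rw [Matrix.diagonal_mul] at h1
      exact h1
  choose π hπ0 hπd hπ using hcol
  choose ρ hρ0 hρd hρ using hrow
  have hsep : ∀ j i i', ‖lam j - d i‖ ≤ L * ε → ‖lam j - d i'‖ ≤ L * ε → i = i' := by
    intro j i i' h1 h2
    by_contra hne
    have h3 := hgap i i' hne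
    have h4 : ‖d i - d i'‖ ≤ ‖lam j - d i'‖ + ‖lam j - d i‖ := by
      have : d i - d i' = (lam j - d i') - (lam j - d i) := by ring
      rw [this]; exact norm_sub_le _ _
    linarith
  have hρπ : ∀ j, ρ j = π j := fun j => hsep j _ _ (hρd j) (hπd j)
  have hinj : Function.Injective π := by
    intro j j' hjj
    by_contra hne
    have h0 : ∑ i, E⁻¹ j i * E i j' = 0 := by
      have := congrFun (congrFun hFE j) j'
      rwa [Matrix.one_apply_ne hne, Matrix.mul_apply] at this
    set q := 2 * (L * ε) / g with hq
    have hq0 : 0 ≤ q := by positivity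
    -- The factor `4 * (L + 1)` in `hsmall` is there for this bound, which forces `L * q ^ 2 < 1`.
    have hqL : 2 * (L + 1) * q ≤ 1 := by
      rw [hq, ← mul_div_assoc, div_le_one hg]
      linarith
    set w := ‖E⁻¹ j (π j)‖ * ‖E (π j) j'‖ with hw
    have hw0 : 0 < w := by
      refine mul_pos (norm_pos_iff.2 ?_) (norm_pos_iff.2 ?_)
      · rw [← hρπ]; exact hρ0 j
      · rw [hjj]; exact hπ0 j'
    rw [← Finset.add_sum_erase _ _ (Finset.mem_univ (π j)), add_eq_zero_iff_eq_neg] at h0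
    have h1 : w ≤ L * (q * q * w) := by
      calc w = ‖∑ i ∈ Finset.univ.erase (π j), E⁻¹ j i * E i j'‖ := by
            rw [hw, ← norm_mul, h0, norm_neg]
        _ ≤ ∑ i ∈ Finset.univ.erase (π j), ‖E⁻¹ j i * E i j'‖ := norm_sum_le _ _
        _ ≤ ∑ _i ∈ Finset.univ.erase (π j), q * q * w := by
            refine Finset.sum_le_sum fun i hi => ?_
            have hi' : i ≠ π j := (Finset.mem_erase.1 hi).1
            have a1 := hρ j i (by rw [hρπ]; exact hi')
            have a2 := hπ j' i (by rw [← hjj]; exact hi')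
            rw [hρπ] at a1
            rw [← hjj] at a2
            rw [norm_mul]
            calc _ ≤ (q * ‖E⁻¹ j (π j)‖) * (q * ‖E (π j) j'‖) :=
                  mul_le_mul a1 a2 (norm_nonneg _) (by positivity)
              _ = _ := by rw [hw]; ring
        _ ≤ ∑ _i : Fin L, q * q * w :=
            Finset.sum_le_sum_of_subset_of_nonneg (Finset.erase_subset _ _)
              fun _ _ _ => by positivity
        _ = L * (q * q * w) := by simp
    have hq1 : q ≤ 1 := by nlinarith
    have hq2 : L * (q * q) < 1 := by nlinarith [mul_nonneg hL hq0]
    nlinarith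
  -- `π` sends a column to its peak; the permutation sought is the inverse, from a path to its
  -- column.
  let e : Equiv.Perm (Fin L) := Equiv.ofBijective π (Finite.injective_iff_bijective.1 hinj)
  have he : ∀ l, π (e.symm l) = l := fun l => e.apply_symm_apply l
  refine ⟨e.symm, fun l => ⟨?_, ?_, fun i hi => ⟨?_, ?_⟩⟩⟩
  · simpa [he] using hπ0 (e.symm l)
  · simpa [he, hρπ] using hρ0 (e.symm l)
  · simpa [he] using hπ (e.symm l) i (by rwa [he])
  · simpa [he, hρπ] using hρ (e.symm l) i (by rwa [hρπ, he])

/-- Second-order accuracy of joint diagonalization: the eigenvectors of a perturbation of a diagonal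
matrix with distinct entries diagonalize perturbations of diagonal matrices up to a permutation,
without a first-order effect on the diagonal. -/
theorem exists_perm_joint_diagonal {α : Type*} {𝓕 : Filter α} {r : α → ℝ}
    (hr : Tendsto r 𝓕 (𝓝 0)) {d : Fin L → ℂ} (hd : Function.Injective d)
    {A E : α → Matrix (Fin L) (Fin L) ℂ} {lam : α → Fin L → ℂ}
    (hA : (fun x => A x - Matrix.diagonal d) =O[𝓕] r)
    (hE : ∀ᶠ x in 𝓕, IsUnit (E x).det ∧ A x = E x * Matrix.diagonal (lam x) * (E x)⁻¹) :
    ∃ σ : α → Equiv.Perm (Fin L), ∀ (M : α → Matrix (Fin L) (Fin L) ℂ) (φ : Fin L → ℂ),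
      (fun x => M x - Matrix.diagonal φ) =O[𝓕] r → ∀ l,
        (fun x => ((E x)⁻¹ * M x * E x) (σ x l) (σ x l) - M x l l) =O[𝓕] fun x => r x * r x := by
  -- Finitely many distinct entries have a minimal gap; with no pair of indices any positive number
  -- will do.
  obtain ⟨g, hg, hgap⟩ : ∃ g : ℝ, 0 < g ∧ ∀ i j, i ≠ j → g ≤ ‖d i - d j‖ := by
    by_cases hne : Nonempty {p : Fin L × Fin L // p.1 ≠ p.2}
    · obtain ⟨p, hp⟩ := Finite.exists_min
        fun p : {p : Fin L × Fin L // p.1 ≠ p.2} => ‖d p.1.1 - d p.1.2‖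
      exact ⟨_, norm_pos_iff.2 (sub_ne_zero.2 (hd.ne p.2)), fun i j hij => hp ⟨(i, j), hij⟩⟩
    · exact ⟨1, one_pos, fun i j hij => (hne ⟨⟨(i, j), hij⟩⟩).elim⟩
  set q : α → ℝ := fun x => 2 * (L * ‖A x - Matrix.diagonal d‖) / g with hq
  have hqr : q =O[𝓕] r := by
    have : q = fun x => (2 * L / g) * ‖A x - Matrix.diagonal d‖ := by
      funext x; rw [hq]; ring
    rw [this]
    exact hA.norm_left.const_mul_left _
  have hsmall : ∀ᶠ x in 𝓕, 4 * (L + 1) * (L * ‖A x - Matrix.diagonal d‖) ≤ g := by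
    have h1 : Tendsto (fun x => 4 * (L + 1) * (L * ‖A x - Matrix.diagonal d‖)) 𝓕 (𝓝 0) := by
      have := (((hA.trans_tendsto hr).norm).const_mul (L : ℝ)).const_mul (4 * ((L : ℝ) + 1))
      simpa using this
    exact h1.eventually_le_const hg
  have hex : ∀ x, ∃ σ : Equiv.Perm (Fin L), 4 * (L + 1) * (L * ‖A x - Matrix.diagonal d‖) ≤ g →
      (IsUnit (E x).det ∧ A x = E x * Matrix.diagonal (lam x) * (E x)⁻¹) →
      ∀ l, E x l (σ l) ≠ 0 ∧ (E x)⁻¹ (σ l) l ≠ 0 ∧ ∀ i, i ≠ l →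
        ‖E x i (σ l)‖ ≤ q x * ‖E x l (σ l)‖ ∧
        ‖(E x)⁻¹ (σ l) i‖ ≤ q x * ‖(E x)⁻¹ (σ l) l‖ := by
    intro x
    by_cases h : 4 * (L + 1) * (L * ‖A x - Matrix.diagonal d‖) ≤ g ∧
      (IsUnit (E x).det ∧ A x = E x * Matrix.diagonal (lam x) * (E x)⁻¹)
    · obtain ⟨σ, hσ⟩ := exists_perm_dominant hg hgap le_rfl h.1 h.2.1 h.2.2
      exact ⟨σ, fun _ _ => hσ⟩
    · exact ⟨1, fun h1 h2 => (h ⟨h1, h2⟩).elim⟩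
  choose σ hσ using hex
  -- The permutation is fixed before `M`, so that one relabelling serves all five modes.
  refine ⟨σ, fun M φ hM l => ?_⟩
  -- Eigenvectors carry an arbitrary scale. Dividing by the dominant entries gives bounded
  -- quantities, and `S` below recovers the lost normalization.
  set e : Fin L → α → ℂ := fun i x => E x i (σ x l) / E x l (σ x l) with he
  set f : Fin L → α → ℂ := fun i x => (E x)⁻¹ (σ x l) i / (E x)⁻¹ (σ x l) l with hf
  have hgood : ∀ᶠ x in 𝓕, E x l (σ x l) ≠ 0 ∧ (E x)⁻¹ (σ x l) l ≠ 0 ∧ IsUnit (E x).det ∧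
      ∀ i, i ≠ l → ‖E x i (σ x l)‖ ≤ q x * ‖E x l (σ x l)‖ ∧
        ‖(E x)⁻¹ (σ x l) i‖ ≤ q x * ‖(E x)⁻¹ (σ x l) l‖ := by
    filter_upwards [hsmall, hE] with x h1 h2
    obtain ⟨a, b, c⟩ := hσ x h1 h2 l
    exact ⟨a, b, h2.1, c⟩
  have hel : (fun x => e l x) =ᶠ[𝓕] fun _ => 1 := by
    filter_upwards [hgood] with x hx using div_self hx.1
  have hfl : (fun x => f l x) =ᶠ[𝓕] fun _ => 1 := by
    filter_upwards [hgood] with x hx using div_self hx.2.1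
  have heO : ∀ i, i ≠ l → e i =O[𝓕] r := by
    intro i hi
    refine IsBigO.trans (IsBigO.of_bound 1 ?_) hqr
    filter_upwards [hgood] with x hx
    rw [he, norm_div, one_mul, div_le_iff₀ (norm_pos_iff.2 hx.1)]
    exact (hx.2.2.2 i hi).1.trans
      (mul_le_mul_of_nonneg_right (Real.le_norm_self _) (norm_nonneg _))
  have hfO : ∀ i, i ≠ l → f i =O[𝓕] r := by
    intro i hi
    refine IsBigO.trans (IsBigO.of_bound 1 ?_) hqr
    filter_upwards [hgood] with x hx
    rw [hf, norm_div, one_mul, div_le_iff₀ (norm_pos_iff.2 hx.2.1)]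
    exact (hx.2.2.2 i hi).2.trans
      (mul_le_mul_of_nonneg_right (Real.le_norm_self _) (norm_nonneg _))
  set S : α → ℂ := fun x => ∑ i, f i x * e i x with hS
  have hS1 : Tendsto S 𝓕 (𝓝 1) := by
    have : (1 : ℂ) = ∑ i, if i = l then 1 else 0 := by simp
    rw [this]
    refine tendsto_finsetSum _ fun i _ => ?_
    by_cases hi : i = l
    · subst hi
      rw [if_pos rfl]
      refine tendsto_const_nhds.congr' ?_
      filter_upwards [hel, hfl] with x h1 h2
      rw [h1, h2, mul_one]
    · rw [if_neg hi]
      simpa using ((hfO i hi).trans_tendsto hr).mul ((heO i hi).trans_tendsto hr)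
  -- Conjugation leaves scalar matrices alone, so the `(l, l)` entry can be made zero. Every term `f
  -- i * M' i k * e k` is then zero or has two first-order factors.
  set M' : α → Matrix (Fin L) (Fin L) ℂ := fun x => M x - M x l l • 1 with hM'
  have hM1 : ∀ i k, (fun x => M' x i k) =O[𝓕] fun _ => (1 : ℝ) := by
    intro i k
    have h1 : ∀ i k, (fun x => M x i k) =O[𝓕] fun _ => (1 : ℝ) := fun i k => by
      have h2 := (isBigO_entry hM i k).trans_tendsto hr
      have h3 : Tendsto (fun x => M x i k) 𝓕 (𝓝 (0 + Matrix.diagonal φ i k)) := by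
        refine (h2.add_const (Matrix.diagonal φ i k)).congr fun x => ?_
        rw [Matrix.sub_apply, sub_add_cancel]
      exact h3.isBigO_one ℝ
    have h4 : (fun x => M x l l * (1 : Matrix (Fin L) (Fin L) ℂ) i k) =O[𝓕] fun _ => (1 : ℝ) := by
      simpa using (h1 l l).mul (isBigO_const_const ((1 : Matrix (Fin L) (Fin L) ℂ) i k)
        (one_ne_zero (α := ℝ)) 𝓕)
    exact (h1 i k).sub h4
  have hMr : ∀ i k, i ≠ k → (fun x => M' x i k) =O[𝓕] r := by
    intro i k hik
    refine (isBigO_entry hM i k).congr_left fun x => ?_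
    simp [hM', Matrix.diagonal_apply_ne _ hik, Matrix.one_apply_ne hik]
  have hterm : ∀ i k, (fun x => f i x * M' x i k * e k x) =O[𝓕] fun x => r x * r x := by
    intro i k
    by_cases hi : i = l <;> by_cases hk : k = l
    · refine (isBigO_zero _ _).congr_left fun x => ?_
      simp [hM', hi, hk]
    · refine ((hMr i k (by rw [hi]; exact Ne.symm hk)).mul (heO k hk)).congr' ?_ EventuallyEq.rfl
      filter_upwards [hfl] with x hx
      rw [hi, hx, one_mul]
    · refine ((hfO i hi).mul (hMr i k (by rw [hk]; exact hi))).congr' ?_ EventuallyEq.rfl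
      filter_upwards [hel] with x hx
      rw [hk, hx, mul_one]
    · simpa using ((hfO i hi).mul (hM1 i k)).mul (heO k hk)
  have hsum : (fun x => (S x)⁻¹ * ∑ i, ∑ k, f i x * M' x i k * e k x)
      =O[𝓕] fun x => r x * r x := by
    have h1 : (fun x => (S x)⁻¹) =O[𝓕] fun _ => (1 : ℝ) :=
      (hS1.inv₀ one_ne_zero).isBigO_one ℝ
    simpa using h1.mul (IsBigO.fun_sum fun i _ => IsBigO.fun_sum fun k _ => hterm i k)
  refine hsum.congr' ?_ EventuallyEq.rfl
  filter_upwards [hgood] with x hx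
  obtain ⟨h1, h2, h3, -⟩ := hx
  set u := (E x)⁻¹ (σ x l) l * E x l (σ x l) with hu
  have hfe : ∀ i, (E x)⁻¹ (σ x l) i = f i x * (E x)⁻¹ (σ x l) l := fun i =>
    (div_mul_cancel₀ _ h2).symm
  have hee : ∀ i, E x i (σ x l) = e i x * E x l (σ x l) := fun i => (div_mul_cancel₀ _ h1).symm
  have hFE : (E x)⁻¹ * E x = 1 := Matrix.nonsing_inv_mul _ h3
  have hone : u * S x = 1 := by
    have := congrFun (congrFun hFE (σ x l)) (σ x l)
    rw [Matrix.mul_apply, Matrix.one_apply_eq] at this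
    rw [← this, hS, Finset.mul_sum]
    refine Finset.sum_congr rfl fun i _ => ?_
    rw [hfe i, hee i]; ring
  have hval : ((E x)⁻¹ * M x * E x) (σ x l) (σ x l) - M x l l =
      ((E x)⁻¹ * M' x * E x) (σ x l) (σ x l) := by
    rw [hM']
    simp only [Matrix.mul_sub, Matrix.sub_mul, Matrix.mul_smul, Matrix.smul_mul,
      hFE, Matrix.sub_apply, Matrix.smul_apply, Matrix.one_apply_eq, smul_eq_mul, mul_one]
  rw [hval, ← eq_inv_of_mul_eq_one_left hone, Finset.mul_sum, Matrix.mul_apply]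
  simp only [Matrix.mul_apply, Finset.sum_mul, Finset.mul_sum]
  rw [Finset.sum_comm]
  refine Finset.sum_congr rfl fun i _ => Finset.sum_congr rfl fun k _ => ?_
  rw [hfe k, hee i, hu]
  ring

end Eigenvectors

/-! ### Shift invariance of the beamspace factors and spatial smoothing. -/

section ShiftInvariance

variable {L : ℕ} {M N : Fin 4 → ℕ}

theorem kron_mul_khatriRao {a b : ℕ} (X : ∀ k : Fin 4, Matrix (Fin (N k)) (Fin (N k)) ℂ)
    (Y : Matrix (Fin a) (Fin b) ℂ) (C : ∀ k : Fin 4, Matrix (Fin (N k)) (Fin L) ℂ)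
    (D : Matrix (Fin b) (Fin L) ℂ) :
    kron X Y * khatriRao C D = khatriRao (fun k => X k * C k) (Y * D) := by
  ext i l
  simp only [kron, khatriRao, Matrix.mul_apply, Matrix.of_apply, Fintype.sum_prod_type,
    Finset.prod_univ_sum, Fintype.piFinset_univ, Finset.sum_mul_sum, Finset.prod_mul_distrib]
  exact Finset.sum_congr rfl fun j _ => Finset.sum_congr rfl fun m _ => by ring

theorem phase_pow (ω : ℝ) (m : ℕ) : phase ω ^ m = Complex.exp (Complex.I * m * ω) := by
  rw [phase, ← Complex.exp_nat_mul]
  congr 1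
  ring

theorem vander_apply (q : ℕ) (ω : Fin L → ℝ) (m : Fin q) (l : Fin L) :
    vander q ω m l = phase (ω l) ^ (m : ℕ) := by
  rw [phase_pow]; rfl

/-- Here `Tᴴ A` is the sum of `t_m Φ ^ m`, and the shift structure says `Fᴴ t_{m+1} = t_m`. Applying
`Q Fᴴ` moves every term down one power of `Φ`; the two unmatched boundary terms are the ones that
`Q` annihilates. -/
theorem RestoresShiftInvariance.mul_vander {a b : ℕ} {T : Matrix (Fin a) (Fin b) ℂ}
    {F Q : Matrix (Fin b) (Fin b) ℂ} (h : RestoresShiftInvariance T F Q) (ω : Fin L → ℝ) :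
    Q * Fᴴ * (Tᴴ * vander a ω) =
      Q * (Tᴴ * vander a ω) * Matrix.diagonal fun l => phase (ω l) := by
  rcases a with _ | a
  · have : vander 0 ω = 0 := by ext i; exact i.elim0
    simp [this]
  have hshift : ∀ (i : Fin a) n, Tᴴ n i.castSucc = (Fᴴ * Tᴴ) n i.succ := by
    intro i n
    have h1 := congrFun (congrFun h.shift i) n
    have e1 : (selFirst (a + 1) * T) i n = T i.castSucc n := by
      rw [Matrix.mul_apply, Finset.sum_eq_single i.castSucc]
      · simp [selFirst]
      · intro j _ hj
        have : ¬ (j : ℕ) = i := fun hh => hj (Fin.ext hh)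
        simp [selFirst, this]
      · simp
    have e2 : ∀ n, (selLast (a + 1) * T) i n = T i.succ n := by
      intro n
      rw [Matrix.mul_apply, Finset.sum_eq_single i.succ]
      · simp [selLast]
      · intro j _ hj
        have : ¬ (j : ℕ) = i + 1 := fun hh => hj (Fin.ext hh)
        simp [selLast, this]
      · simp
    rw [e1, Matrix.mul_apply] at h1
    rw [Matrix.conjTranspose_apply, h1, star_sum, Matrix.mul_apply]
    refine Finset.sum_congr rfl fun k _ => ?_
    rw [e2, StarMul.star_mul, Matrix.conjTranspose_apply, Matrix.conjTranspose_apply]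
  have hcast : ∀ n (i : Fin a), (Q * Tᴴ) n i.castSucc = (Q * Fᴴ * Tᴴ) n i.succ := by
    intro n i
    rw [Matrix.mul_assoc, Matrix.mul_apply, Matrix.mul_apply]
    exact Finset.sum_congr rfl fun k _ => by rw [hshift]
  have hlast : ∀ n, (Q * Tᴴ) n (Fin.last a) = 0 := fun n =>
    congrFun (h.last (Fin.last a) (by simp)) n
  have hfirst : ∀ n, (Q * Fᴴ * Tᴴ) n 0 = 0 := fun n => congrFun (h.first 0 (by simp)) n
  ext n l
  rw [Matrix.mul_diagonal, ← Matrix.mul_assoc, ← Matrix.mul_assoc, Matrix.mul_apply,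
    Matrix.mul_apply, Fin.sum_univ_succ, Fin.sum_univ_castSucc, hlast, hfirst, zero_mul, zero_mul,
    zero_add, add_zero, Finset.sum_mul]
  refine Finset.sum_congr rfl fun i _ => ?_
  rw [hcast, vander_apply, vander_apply, Fin.val_succ, Fin.val_castSucc, pow_succ, mul_assoc]

theorem selFirst_mul_vander_apply (q : ℕ) (ω : Fin L → ℝ) (i : Fin (q - 1)) (l : Fin L) :
    (selFirst q * vander q ω) i l = phase (ω l) ^ (i : ℕ) := by
  rw [Matrix.mul_apply, Finset.sum_eq_single ⟨i, by omega⟩]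
  · rw [vander_apply]; simp [selFirst]
  · intro j _ hj
    have : ¬ (j : ℕ) = i := fun hh => hj (Fin.ext hh)
    simp [selFirst, this]
  · simp

theorem selLast_mul_vander (q : ℕ) (ω : Fin L → ℝ) :
    selLast q * vander q ω =
      selFirst q * vander q ω * Matrix.diagonal fun l => phase (ω l) := by
  ext i l
  rw [Matrix.mul_diagonal, selFirst_mul_vander_apply, Matrix.mul_apply,
    Finset.sum_eq_single ⟨i + 1, by omega⟩]
  · rw [vander_apply]; simp [selLast, pow_succ]
  · intro j _ hj
    have : ¬ (j : ℕ) = i + 1 := fun hh => hj (Fin.ext hh)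
    simp [selLast, this]
  · simp

/-- A Kronecker product acts on a Khatri-Rao product mode by mode, so the relation for mode `k`
passes to the whole product with the other factors untouched. -/
theorem J₂_mul_beamMat {T : ∀ k, Matrix (Fin (M k)) (Fin (N k)) ℂ}
    {F Q : ∀ k, Matrix (Fin (N k)) (Fin (N k)) ℂ}
    (hT : ∀ k, RestoresShiftInvariance (T k) (F k) (Q k)) (ω : Fin L → Fin 5 → ℝ) (q : ℕ)
    (k : Fin 4) :
    J₂ F Q q k * beamMat T ω q =
      J₁ Q q k * beamMat T ω q * Matrix.diagonal fun l => phase (ω l k.castSucc) := by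
  rw [J₁, J₂, beamMat, kron_mul_khatriRao, kron_mul_khatriRao]
  ext i l
  rw [Matrix.mul_diagonal]
  simp only [khatriRao, Matrix.of_apply]
  rw [← Finset.mul_prod_erase _ _ (Finset.mem_univ k),
    ← Finset.mul_prod_erase _ _ (Finset.mem_univ k)]
  have h1 := congrFun (congrFun ((hT k).mul_vander fun l => ω l k.castSucc) (i.1 k)) l
  rw [Matrix.mul_diagonal] at h1
  have h2 : ∀ X X' : Matrix (Fin (N k)) (Fin (N k)) ℂ,
      ∏ j ∈ Finset.univ.erase k, (Function.update (fun k' => (1 : Matrix (Fin (N k')) (Fin (N k')) ℂ))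
        k X j * modeMat T ω j) (i.1 j) l =
      ∏ j ∈ Finset.univ.erase k, (Function.update (fun k' => (1 : Matrix (Fin (N k')) (Fin (N k')) ℂ))
        k X' j * modeMat T ω j) (i.1 j) l := by
    intro X X'
    refine Finset.prod_congr rfl fun j hj => ?_
    rw [Function.update_of_ne (Finset.ne_of_mem_erase hj),
      Function.update_of_ne (Finset.ne_of_mem_erase hj)]
  rw [h2 _ (Q k), Function.update_self, Function.update_self, modeMat, h1]
  ring

theorem J₂freq_mul_beamMat (T : ∀ k, Matrix (Fin (M k)) (Fin (N k)) ℂ) (ω : Fin L → Fin 5 → ℝ)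
    (q : ℕ) :
    J₂freq N q * beamMat T ω q =
      J₁freq N q * beamMat T ω q * Matrix.diagonal fun l => phase (ω l (Fin.last 4)) := by
  rw [J₁freq, J₂freq, beamMat, kron_mul_khatriRao, kron_mul_khatriRao, selLast_mul_vander]
  ext i l
  simp only [khatriRao, Matrix.of_apply, Matrix.mul_diagonal, mul_assoc]

/-- The first `q` frequency positions of the longer matrix form the shorter one, so a left inverse
extends. This transfers full column rank from `P` to `B`. -/
theorem isUnit_det_gram_beamMat {T : ∀ k, Matrix (Fin (M k)) (Fin (N k)) ℂ}
    {ω : Fin L → Fin 5 → ℝ} {q q' : ℕ} (hq : q ≤ q')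
    (h : IsUnit ((beamMat T ω q)ᴴ * beamMat T ω q).det) :
    IsUnit ((beamMat T ω q')ᴴ * beamMat T ω q').det := by
  let S : Matrix (Idx N q) (Idx N q') ℂ :=
    kron (fun k => 1) (Matrix.of fun i j => if Fin.castLE hq i = j then 1 else 0)
  have hS : S * beamMat T ω q' = beamMat T ω q := by
    rw [beamMat, beamMat, kron_mul_khatriRao]
    congr 1
    · funext k; rw [Matrix.one_mul]
    · ext i l
      simp [Matrix.mul_apply, vander_apply]
  apply isUnit_det_gram_of_left_inverse (X := pinv (beamMat T ω q) * S)
  rw [Matrix.mul_assoc, hS, pinv_mul_self h]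

/-- Spatial smoothing of the noiseless channel: `𝒮(B γ) = P Diag(γ) Gᵀ`. -/
theorem smooth_beamMat_mulVec {K₅ L₅ M₅ : ℕ} (hM₅ : L₅ + K₅ = M₅ + 1)
    (T : ∀ k, Matrix (Fin (M k)) (Fin (N k)) ℂ) (ω : Fin L → Fin 5 → ℝ) (γ : Fin L → ℂ) :
    smooth K₅ L₅ (beamMat T ω M₅ *ᵥ γ) =
      beamMat T ω K₅ * (Matrix.diagonal γ * (vander L₅ fun l => ω l (Fin.last 4))ᵀ) := by
  ext i ℓ
  have hlt : (i.2 : ℕ) + ℓ < M₅ := by omega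
  simp only [smooth, Matrix.of_apply]
  rw [Finset.sum_eq_single ⟨i.2 + ℓ, hlt⟩]
  · rw [if_pos rfl, Matrix.mul_apply, Matrix.mulVec, dotProduct]
    refine Finset.sum_congr rfl fun l _ => ?_
    simp only [beamMat, khatriRao, Matrix.of_apply, vander_apply, Matrix.diagonal_mul,
      Matrix.transpose_apply, pow_add]
    ring
  · intro j _ hj
    exact if_neg fun hh => hj (Fin.ext hh)
  · simp

theorem smooth_add {K₅ L₅ M₅ : ℕ} (h h' : Idx N M₅ → ℂ) :
    smooth K₅ L₅ (h + h') = smooth K₅ L₅ h + smooth K₅ L₅ h' := by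
  ext i ℓ
  simp only [smooth, Matrix.of_apply, Matrix.add_apply, ← Finset.sum_add_distrib, Pi.add_apply]
  refine Finset.sum_congr rfl fun m _ => ?_
  split_ifs <;> simp

theorem smooth_isBigO {K₅ L₅ M₅ : ℕ} (𝓕 : Filter (Idx N M₅ → ℂ)) :
    (fun h : Idx N M₅ → ℂ => smooth K₅ L₅ h) =O[𝓕] fun h => ‖h‖ := by
  refine IsBigO.of_bound M₅ (Eventually.of_forall fun h => ?_)
  rw [norm_norm]
  refine (Matrix.norm_le_iff (by positivity)).2 fun i ℓ => ?_
  simp only [smooth, Matrix.of_apply]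
  refine (norm_sum_le _ _).trans ?_
  calc ∑ m : Fin M₅, ‖if (m : ℕ) = (i.2 : ℕ) + ℓ then h (i.1, m) else 0‖
      ≤ ∑ _m : Fin M₅, ‖h‖ := by
        refine Finset.sum_le_sum fun m _ => ?_
        split_ifs
        · exact norm_le_pi_norm h _
        · simp
    _ = _ := by simp

end ShiftInvariance

/-! ### First-order solution of the shift equations. -/

section FirstOrder

variable {α m κ : Type*} [Fintype m] [Fintype κ] {L : ℕ} {𝓕 : Filter α} {r : α → ℝ}

/-- First-order expansion of the least-squares solution of a perturbed shift invariance equation,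
in the basis of the unperturbed signal subspace. -/
theorem shift_solution_expansion (hr : Tendsto r 𝓕 (𝓝 0)) {P : Matrix m (Fin L) ℂ}
    {A B : Matrix κ m ℂ} {φ : Fin L → ℂ} (hAB : B * P = A * P * Matrix.diagonal φ)
    (hA : IsUnit ((A * P)ᴴ * (A * P)).det) {U D S : α → Matrix m (Fin L) ℂ}
    {C : α → Matrix (Fin L) (Fin L) ℂ} (hD : D =O[𝓕] r) (hS : S =O[𝓕] fun x => r x * r x)
    (hU : ∀ᶠ x in 𝓕, IsUnit (C x).det ∧ U x * C x = P + D x + S x) :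
    (fun x => (C x)⁻¹ * (pinv (A * U x) * (B * U x)) * C x - Matrix.diagonal φ) =O[𝓕] r ∧
    ∀ l, (fun x => ((C x)⁻¹ * (pinv (A * U x) * (B * U x)) * C x) l l - φ l -
      (pinv (A * P) * (B - φ l • A)).row l ⬝ᵥ (D x).col l) =o[𝓕] r := by
  have hrr : (fun x => r x * r x) =o[𝓕] r := by
    simpa using ((isLittleO_one_iff ℝ).2 hr).mul_isBigO (isBigO_refl r 𝓕)
  have hSo : S =o[𝓕] r := hS.trans_isLittleO hrr
  have hDS : (fun x => D x + S x) =O[𝓕] r := hD.add hSo.isBigO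
  have hlim : Tendsto (fun x => A * (P + D x + S x)) 𝓕 (𝓝 (A * P)) := by
    refine tendsto_matrix_mul tendsto_const_nhds ?_
    have h1 := (hDS.trans_tendsto hr).const_add P
    rw [add_zero] at h1
    exact h1.congr fun x => (add_assoc _ _ _).symm
  have hp := tendsto_pinv hA hlim
  -- `X` is the defect of the shift equation for `U C`: the contribution of `P` drops out by `hAB`.
  set X : α → Matrix κ (Fin L) ℂ :=
    fun x => B * (D x + S x) - A * (D x + S x) * Matrix.diagonal φ with hX
  have hXO : X =O[𝓕] r := (isBigO_const_matrix_mul B hDS).sub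
    (isBigO_matrix_mul_const (isBigO_const_matrix_mul A hDS) _)
  -- No approximation enters here: in the basis given by `C` the error is exactly a pseudoinverse
  -- times the defect.
  have hexact : ∀ᶠ x in 𝓕, (C x)⁻¹ * (pinv (A * U x) * (B * U x)) * C x - Matrix.diagonal φ =
      pinv (A * (P + D x + S x)) * X x := by
    filter_upwards [hU, eventually_isUnit_det hA (tendsto_gram hlim)] with x hx hx'
    obtain ⟨hC, hUC⟩ := hx
    rw [← hUC] at hx' ⊢
    have hC' : IsUnit (C x)⁻¹.det := Matrix.isUnit_nonsing_inv_det _ hC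
    have e1 : A * U x = A * (U x * C x) * (C x)⁻¹ := by
      rw [Matrix.mul_assoc, Matrix.mul_assoc, Matrix.mul_nonsing_inv _ hC, Matrix.mul_one]
    have e2 : pinv (A * U x) = C x * pinv (A * (U x * C x)) := by
      conv_lhs => rw [e1]
      rw [pinv_mul_of_isUnit hx' hC', Matrix.nonsing_inv_nonsing_inv _ hC]
    have e3 : X x = B * (U x * C x) - A * (U x * C x) * Matrix.diagonal φ := by
      rw [hUC, add_assoc, Matrix.mul_add, hAB, Matrix.mul_add A, Matrix.add_mul,
        add_sub_add_left_eq_sub]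
    rw [e2, e3, Matrix.mul_sub, ← Matrix.mul_assoc _ (A * (U x * C x)), pinv_mul_self hx',
      Matrix.one_mul]
    congr 1
    simp only [← Matrix.mul_assoc]
    rw [Matrix.nonsing_inv_mul _ hC, Matrix.one_mul]
  have hO1 : (fun x => pinv (A * (P + D x + S x))) =O[𝓕] fun _ => (1 : ℝ) := hp.isBigO_one ℝ
  constructor
  · have h1 : (fun x => pinv (A * (P + D x + S x)) * X x) =O[𝓕] r := by
      simpa using isBigO_matrix_mul hO1 hXO
    refine h1.congr' ?_ EventuallyEq.rfl
    filter_upwards [hexact] with x hx using hx.symm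
  · intro l
    -- As `X` is already of first order, convergence of the pseudoinverse suffices and no rate is
    -- needed.
    have h1 : (fun x => (pinv (A * (P + D x + S x)) - pinv (A * P)) * X x) =o[𝓕] r := by
      refine isLittleO_matrix_mul ?_ hXO
      have := hp.sub_const (pinv (A * P))
      rwa [sub_self] at this
    have h2 : (fun x => pinv (A * P) * (B * S x - A * S x * Matrix.diagonal φ)) =o[𝓕] r := by
      refine (isBigO_const_matrix_mul _ ?_).trans_isLittleO hrr
      exact (isBigO_const_matrix_mul B hS).sub
        (isBigO_matrix_mul_const (isBigO_const_matrix_mul A hS) _)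
    refine (isLittleO_entry (h1.add h2) l l).congr' ?_ EventuallyEq.rfl
    filter_upwards [hexact] with x hx
    have h3 := congrFun (congrFun hx l) l
    rw [Matrix.sub_apply, Matrix.diagonal_apply_eq] at h3
    rw [h3]
    have h4 : (pinv (A * P) * (B - φ l • A)).row l ⬝ᵥ (D x).col l =
        (pinv (A * P) * (B * D x - A * D x * Matrix.diagonal φ)) l l := by
      have h5 : (pinv (A * P) * (B - φ l • A)).row l ⬝ᵥ (D x).col l =
        (pinv (A * P) * (B - φ l • A) * D x) l l := rfl
      rw [h5, Matrix.mul_assoc, Matrix.sub_mul, Matrix.smul_mul]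
      rw [Matrix.mul_sub, Matrix.mul_sub, Matrix.mul_smul, ← Matrix.mul_assoc _ _ (Matrix.diagonal φ),
        Matrix.sub_apply, Matrix.sub_apply, Matrix.mul_diagonal, Matrix.smul_apply, smul_eq_mul,
        mul_comm (φ l)]
    have h5 : ∀ Y : Matrix (Fin L) κ ℂ, (Y - pinv (A * P)) * X x +
        pinv (A * P) * (B * S x - A * S x * Matrix.diagonal φ) =
        Y * X x - pinv (A * P) * (B * D x - A * D x * Matrix.diagonal φ) := by
      intro Y
      rw [Matrix.sub_mul, hX]
      simp only [Matrix.mul_add, Matrix.mul_sub, Matrix.add_mul]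
      abel
    rw [h5, h4, Matrix.sub_apply]

end FirstOrder

/-! ### Expansion of the estimated phases. -/

section PhaseEstimates

variable {L K₅ L₅ M₅ : ℕ} {M N : Fin 4 → ℕ}

theorem star_phase_mul_phase (ω : ℝ) : star (phase ω) * phase ω = 1 := by
  rw [phase, Complex.star_def, ← Complex.exp_conj, ← Complex.exp_add]
  simp

theorem phase_ne_zero (ω : ℝ) : phase ω ≠ 0 := Complex.exp_ne_zero _

/-- The first-order error of a diagonal entry, written with the convolution vector. -/
theorem lamRow_dotProduct_smooth (T : ∀ k, Matrix (Fin (M k)) (Fin (N k)) ℂ)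
    (F Q : ∀ k, Matrix (Fin (N k)) (Fin (N k)) ℂ) (ω : Fin L → Fin 5 → ℝ) (γ : Fin L → ℂ)
    (Δh : Idx N M₅ → ℂ) (l : Fin L) (n : Fin 5) :
    lamRow T F Q K₅ ω l n ⬝ᵥ (smooth K₅ L₅ Δh *
      (pinv (vander L₅ fun l => ω l (Fin.last 4))ᵀ * Matrix.diagonal fun l => (γ l)⁻¹)).col l =
    phase (ω l n) * (star (upsilon T F Q K₅ L₅ ω γ l n) ⬝ᵥ Δh) := by
  have h1 : ∀ i, phase (ω l n) * star (upsilon T F Q K₅ L₅ (M₅ := M₅) ω γ l n) i =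
      ∑ k : Fin K₅, ∑ ℓ : Fin L₅, if (k : ℕ) + ℓ = i.2 then
        lamRow T F Q K₅ ω l n (i.1, k) *
          (pinv (vander L₅ fun l => ω l (Fin.last 4))ᵀ ℓ l * (γ l)⁻¹) else 0 := by
    intro i
    have h2 : star (xi T F Q K₅ L₅ (M₅ := M₅) ω l n i) =
        ∑ k : Fin K₅, ∑ ℓ : Fin L₅, if (k : ℕ) + ℓ = i.2 then
          lamRow T F Q K₅ ω l n (i.1, k) *
            pinv (vander L₅ fun l => ω l (Fin.last 4))ᵀ ℓ l else 0 := by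
      simp only [xi, chi, star_sum]
      refine Finset.sum_congr rfl fun k _ => Finset.sum_congr rfl fun ℓ _ => ?_
      split_ifs
      · rw [StarMul.star_mul, star_star, star_star, mul_comm]
      · exact star_zero _
    rw [Pi.star_apply, upsilon, div_eq_mul_inv, StarMul.star_mul, StarMul.star_mul, star_inv₀,
      star_star, h2]
    -- The factor `Φ` in `υ` is conjugated and cancels, as `|Φ| = 1`.
    have h3 : ∀ a b : ℂ, phase (ω l n) * (a * (b * star (phase (ω l n)))) = b * a := fun a b => by
      linear_combination (a * b) * star_phase_mul_phase (ω l n)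
    rw [h3, Finset.sum_mul]
    refine Finset.sum_congr rfl fun k _ => ?_
    rw [Finset.sum_mul]
    refine Finset.sum_congr rfl fun ℓ _ => ?_
    split_ifs
    · ring
    · exact zero_mul _
  have hcol : ∀ p : Idx N K₅, (smooth K₅ L₅ Δh * (pinv (vander L₅ fun l => ω l (Fin.last 4))ᵀ *
      Matrix.diagonal fun l => (γ l)⁻¹)).col l p = ∑ ℓ : Fin L₅, smooth K₅ L₅ Δh p ℓ *
        (pinv (vander L₅ fun l => ω l (Fin.last 4))ᵀ ℓ l * (γ l)⁻¹) := by
    intro p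
    rw [Matrix.col_apply, Matrix.mul_apply]
    simp only [Matrix.mul_diagonal]
  rw [dotProduct, dotProduct, Finset.mul_sum]
  simp only [← mul_assoc (phase (ω l n)), h1, hcol]
  -- What remains is that convolution is adjoint to smoothing: frequency position `m` collects the
  -- pairs with `k + ℓ = m`.
  rw [Fintype.sum_prod_type, Fintype.sum_prod_type]
  refine Finset.sum_congr rfl fun j _ => ?_
  simp only [Finset.sum_mul]
  rw [Finset.sum_comm]
  refine Finset.sum_congr rfl fun k _ => ?_
  rw [Finset.sum_comm]
  rw [Finset.mul_sum]
  refine Finset.sum_congr rfl fun ℓ _ => ?_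
  simp only [smooth, Matrix.of_apply, Finset.sum_mul, Finset.mul_sum]
  refine Finset.sum_congr rfl fun m _ => ?_
  by_cases h : (m : ℕ) = k + ℓ
  · rw [if_pos h, if_pos h.symm]; ring
  · rw [if_neg h, if_neg (Ne.symm h)]; ring

/-- First-order expansion of the estimated phases. -/
theorem diagonal_entries_expansion (hM₅ : L₅ + K₅ = M₅ + 1)
    {T : ∀ k, Matrix (Fin (M k)) (Fin (N k)) ℂ} {F Q : ∀ k, Matrix (Fin (N k)) (Fin (N k)) ℂ}
    (hT : ∀ k, RestoresShiftInvariance (T k) (F k) (Q k))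
    {ω : Fin L → Fin 5 → ℝ} {γ : Fin L → ℂ} (hγ : ∀ l, γ l ≠ 0)
    (hJ : ∀ k, (J₁ Q K₅ k * beamMat T ω K₅).rank = L)
    (hJ₅ : (J₁freq N K₅ * beamMat T ω K₅).rank = L)
    (hG : (vander L₅ fun l => ω l (Fin.last 4)).rank = L)
    {β : Fin 5 → ℂ} (hβ : Function.Injective fun l => ∑ n, β n * phase (ω l n))
    {U : (Idx N M₅ → ℂ) → Matrix (Idx N K₅) (Fin L) ℂ}
    {E : (Idx N M₅ → ℂ) → Matrix (Fin L) (Fin L) ℂ} {lam : (Idx N M₅ → ℂ) → Fin L → ℂ}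
    (hU : ∀ᶠ Δh in 𝓝 (0 : Idx N M₅ → ℂ),
      IsLeadingLeftSingular (smooth K₅ L₅ (beamMat T ω M₅ *ᵥ γ + Δh)) (U Δh))
    (hE : ∀ᶠ Δh in 𝓝 (0 : Idx N M₅ → ℂ), IsUnit (E Δh).det ∧
      ∑ n, β n • shiftMat F Q (U Δh) n = E Δh * Matrix.diagonal (lam Δh) * (E Δh)⁻¹) :
    ∃ σ : (Idx N M₅ → ℂ) → Equiv.Perm (Fin L), ∀ l n,
      (fun Δh => ((E Δh)⁻¹ * shiftMat F Q (U Δh) n * E Δh) (σ Δh l) (σ Δh l) - phase (ω l n) -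
        phase (ω l n) * (star (upsilon T F Q K₅ L₅ ω γ l n) ⬝ᵥ Δh))
        =o[𝓝 0] fun Δh : Idx N M₅ → ℂ => ‖Δh‖ := by
  have hr : Tendsto (fun Δh : Idx N M₅ → ℂ => ‖Δh‖) (𝓝 0) (𝓝 0) := tendsto_norm_zero
  have hgram : ∀ k, IsUnit ((J₁ Q K₅ k * beamMat T ω K₅)ᴴ * (J₁ Q K₅ k * beamMat T ω K₅)).det :=
    fun k => isUnit_det_gram_of_rank (by simpa using hJ k)
  have hgram₅ : IsUnit ((J₁freq N K₅ * beamMat T ω K₅)ᴴ * (J₁freq N K₅ * beamMat T ω K₅)).det :=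
    isUnit_det_gram_of_rank (by simpa using hJ₅)
  set G := vander L₅ fun l => ω l (Fin.last 4) with hGdef
  set W : Matrix (Fin L₅) (Fin L) ℂ := pinv Gᵀ * Matrix.diagonal fun l => (γ l)⁻¹ with hWdef
  -- Full column rank of `G` gives `Gᵀ` some right inverse, and this promotes the Penrose identity
  -- to a right inverse property of `pinv Gᵀ`.
  have hGp : Gᵀ * pinv Gᵀ = 1 := by
    have h1 := pinv_mul_self (isUnit_det_gram_of_rank (A := G) (by simpa using hG))
    have h2 : Gᵀ * (pinv G)ᵀ = 1 := by rw [← Matrix.transpose_mul, h1, Matrix.transpose_one]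
    calc Gᵀ * pinv Gᵀ = Gᵀ * pinv Gᵀ * (Gᵀ * (pinv G)ᵀ) := by rw [h2, Matrix.mul_one]
      _ = Gᵀ * pinv Gᵀ * Gᵀ * (pinv G)ᵀ := by simp only [Matrix.mul_assoc]
      _ = 1 := by rw [(pinv_spec Gᵀ).1, h2]
  have hdd : Matrix.diagonal γ * Matrix.diagonal (fun l => (γ l)⁻¹) = 1 := by
    rw [Matrix.diagonal_mul_diagonal, ← Matrix.diagonal_one]
    congr 1
    funext l
    exact mul_inv_cancel₀ (hγ l)
  have hKW : Matrix.diagonal γ * Gᵀ * W = 1 := by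
    rw [hWdef, Matrix.mul_assoc, ← Matrix.mul_assoc Gᵀ, hGp, Matrix.one_mul, hdd]
  -- The pseudoinverse, unlike other right inverses, has its columns in the range of the conjugate
  -- transpose; this is where its choice in `χ` matters.
  obtain ⟨Z, hZ⟩ : ∃ Z : Matrix (Fin L) (Fin L) ℂ, W = (Matrix.diagonal γ * Gᵀ)ᴴ * Z := by
    refine ⟨Matrix.diagonal (fun l => star (γ l)⁻¹) * ((pinv Gᵀ)ᴴ * W), ?_⟩
    have h1 : (Matrix.diagonal γ)ᴴ * Matrix.diagonal (fun l => star (γ l)⁻¹) = 1 := by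
      rw [Matrix.diagonal_conjTranspose, Matrix.diagonal_mul_diagonal, ← Matrix.diagonal_one]
      congr 1
      funext l
      rw [Pi.star_apply, ← StarMul.star_mul, inv_mul_cancel₀ (hγ l), star_one]
    obtain ⟨-, h2, -, h4⟩ := pinv_spec Gᵀ
    rw [Matrix.conjTranspose_mul, Matrix.mul_assoc, ← Matrix.mul_assoc (Matrix.diagonal γ)ᴴ, h1,
      Matrix.one_mul, ← Matrix.mul_assoc, ← Matrix.conjTranspose_mul, h4.eq, hWdef,
      ← Matrix.mul_assoc, h2]
  have hP : ((pinv (J₁freq N K₅ * beamMat T ω K₅) * J₁freq N K₅)ᴴ)ᴴ * beamMat T ω K₅ = 1 := by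
    rw [Matrix.conjTranspose_conjTranspose, Matrix.mul_assoc, pinv_mul_self hgram₅]
  have hU' : ∀ᶠ Δh in 𝓝 (0 : Idx N M₅ → ℂ), IsLeadingLeftSingular
      (beamMat T ω K₅ * (Matrix.diagonal γ * Gᵀ) + smooth K₅ L₅ Δh) (U Δh) := by
    filter_upwards [hU] with x hx
    rwa [smooth_add, smooth_beamMat_mulVec hM₅] at hx
  obtain ⟨C, S, hS, hC⟩ := exists_basis_change hr hP hKW hZ (smooth_isBigO _) hU'
  have hD : (fun Δh : Idx N M₅ → ℂ => smooth K₅ L₅ Δh * W) =O[𝓝 0] fun Δh => ‖Δh‖ :=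
    isBigO_matrix_mul_const (smooth_isBigO _) W
  have hexp : ∀ n : Fin 5, (fun Δh => (C Δh)⁻¹ * shiftMat F Q (U Δh) n * C Δh -
        Matrix.diagonal fun l => phase (ω l n)) =O[𝓝 0] (fun Δh : Idx N M₅ → ℂ => ‖Δh‖) ∧
      ∀ l, (fun Δh => ((C Δh)⁻¹ * shiftMat F Q (U Δh) n * C Δh) l l - phase (ω l n) -
        lamRow T F Q K₅ ω l n ⬝ᵥ (smooth K₅ L₅ Δh * W).col l) =o[𝓝 0]
          (fun Δh : Idx N M₅ → ℂ => ‖Δh‖) := by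
    intro n
    induction n using Fin.lastCases with
    | last =>
      simp only [shiftMat, lamRow, Fin.snoc_last]
      exact shift_solution_expansion hr (J₂freq_mul_beamMat T ω K₅) hgram₅ hD hS hC
    | cast k =>
      simp only [shiftMat, lamRow, Fin.snoc_castSucc]
      exact shift_solution_expansion hr (J₂_mul_beamMat hT ω K₅ k) (hgram k) hD hS hC
  have hA : (fun Δh => ∑ n, β n • ((C Δh)⁻¹ * shiftMat F Q (U Δh) n * C Δh) -
      Matrix.diagonal fun l => ∑ n, β n * phase (ω l n))
        =O[𝓝 0] (fun Δh : Idx N M₅ → ℂ => ‖Δh‖) := by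
    have h1 : (fun Δh => ∑ n, β n • ((C Δh)⁻¹ * shiftMat F Q (U Δh) n * C Δh -
        Matrix.diagonal fun l => phase (ω l n))) =O[𝓝 0] (fun Δh : Idx N M₅ → ℂ => ‖Δh‖) :=
      IsBigO.fun_sum fun n _ => (hexp n).1.const_smul_left (β n)
    refine h1.congr_left fun Δh => ?_
    have h2 : (Matrix.diagonal fun l => ∑ n, β n * phase (ω l n)) =
        ∑ n, β n • Matrix.diagonal fun l => phase (ω l n) := by
      ext i j
      rw [Matrix.sum_apply]
      by_cases hij : i = j
      · subst hij; simp
      · simp [hij]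
    rw [h2, ← Finset.sum_sub_distrib]
    exact Finset.sum_congr rfl fun n _ => smul_sub _ _ _
  -- In the basis given by `C` the eigenvector matrix is `C⁻¹ E`. The diagonal entries of `E⁻¹ Γ E`
  -- are unaffected by this change.
  have hE' : ∀ᶠ Δh in 𝓝 (0 : Idx N M₅ → ℂ), IsUnit ((C Δh)⁻¹ * E Δh).det ∧
      ∑ n, β n • ((C Δh)⁻¹ * shiftMat F Q (U Δh) n * C Δh) =
        (C Δh)⁻¹ * E Δh * Matrix.diagonal (lam Δh) * ((C Δh)⁻¹ * E Δh)⁻¹ := by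
    filter_upwards [hE, hC] with x hx hCx
    refine ⟨?_, ?_⟩
    · rw [Matrix.det_mul]
      exact (Matrix.isUnit_nonsing_inv_det _ hCx.1).mul hx.1
    · have h1 : ∑ n, β n • ((C x)⁻¹ * shiftMat F Q (U x) n * C x) =
          (C x)⁻¹ * (∑ n, β n • shiftMat F Q (U x) n) * C x := by
        rw [Matrix.mul_sum, Matrix.sum_mul]
        refine Finset.sum_congr rfl fun n _ => ?_
        rw [Matrix.mul_smul, Matrix.smul_mul]
      rw [h1, hx.2, Matrix.mul_inv_rev, Matrix.nonsing_inv_nonsing_inv _ hCx.1]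
      simp only [Matrix.mul_assoc]
  obtain ⟨σ, hσ⟩ := exists_perm_joint_diagonal hr hβ hA hE'
  refine ⟨σ, fun l n => ?_⟩
  have hrr : (fun Δh : Idx N M₅ → ℂ => ‖Δh‖ * ‖Δh‖) =o[𝓝 0] fun Δh => ‖Δh‖ := by
    simpa using ((isLittleO_one_iff ℝ).2 hr).mul_isBigO (isBigO_refl _ (𝓝 0))
  refine (((hσ _ _ (hexp n).1 l).trans_isLittleO hrr).add ((hexp n).2 l)).congr' ?_
    EventuallyEq.rfl
  filter_upwards [hC] with x hCx
  have h1 : ((C x)⁻¹ * E x)⁻¹ * ((C x)⁻¹ * shiftMat F Q (U x) n * C x) * ((C x)⁻¹ * E x) =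
      (E x)⁻¹ * shiftMat F Q (U x) n * E x := by
    rw [Matrix.mul_inv_rev, Matrix.nonsing_inv_nonsing_inv _ hCx.1]
    calc _ = (E x)⁻¹ * (C x * (C x)⁻¹) * shiftMat F Q (U x) n * (C x * (C x)⁻¹) * E x := by
          simp only [Matrix.mul_assoc]
      _ = _ := by rw [Matrix.mul_nonsing_inv _ hCx.1, Matrix.mul_one, Matrix.mul_one]
  rw [h1, lamRow_dotProduct_smooth]
  ring

end PhaseEstimates

/-! ### From phases to angles and delays. -/

section FrequencyErrors

variable {α : Type*} {𝓕 : Filter α} {r : α → ℝ}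

theorem eq_norm_mul_phase_arg (z : ℂ) : z = ‖z‖ * phase z.arg := by
  rw [phase, mul_comm Complex.I, Complex.norm_mul_exp_arg_mul_I]

/-- First-order error of the frequency read off from a perturbed phase factor. -/
theorem log_im_expansion (hr : Tendsto r 𝓕 (𝓝 0)) {ω : ℝ} {z w : α → ℂ} (hw : w =O[𝓕] r)
    (hz : (fun x => z x - phase ω - phase ω * w x) =o[𝓕] r) :
    (fun x => (Complex.log (z x / phase ω)).im - (w x).im) =o[𝓕] r ∧
    ∀ᶠ x in 𝓕, z x ≠ 0 ∧
      z x = ‖z x‖ * phase (ω + (Complex.log (z x / phase ω)).im) := by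
  -- Division by `phase ω` centres the logarithm at `1`, away from its branch cut. The branch is
  -- treated separately in the two lemmas below.
  have hdiv : (fun x => (z x / phase ω - 1) - w x) =o[𝓕] r := by
    refine (hz.const_mul_left (phase ω)⁻¹).congr_left fun x => ?_
    have := phase_ne_zero ω
    field_simp
  have hO : (fun x => z x / phase ω - 1) =O[𝓕] r := by
    simpa using hdiv.isBigO.add hw
  have hlim : Tendsto (fun x => z x / phase ω) 𝓕 (𝓝 1) := by
    simpa using (hO.trans_tendsto hr).add_const 1
  have hlog : (fun x => Complex.log (z x / phase ω) - (z x / phase ω - 1)) =o[𝓕] r := by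
    have h1 := (Complex.hasStrictDerivAt_log Complex.one_mem_slitPlane).hasDerivAt.isLittleO
    refine ((h1.comp_tendsto hlim).trans_isBigO hO).congr_left fun x => ?_
    simp
  constructor
  · refine (IsBigO.of_bound 1 (Eventually.of_forall fun x => ?_)).trans_isLittleO (hlog.add hdiv)
    rw [← Complex.sub_im, one_mul, Real.norm_eq_abs]
    refine (Complex.abs_im_le_norm _).trans_eq ?_
    congr 1
    ring
  · filter_upwards [hlim.eventually_ne one_ne_zero] with x hx
    have hz0 : z x ≠ 0 := by
      rintro h; exact hx (by rw [h, zero_div])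
    refine ⟨hz0, ?_⟩
    have hn : ‖z x / phase ω‖ = ‖z x‖ := by
      rw [norm_div, phase, mul_comm, Complex.norm_exp_ofReal_mul_I, div_one]
    have h1 : z x / phase ω = ‖z x‖ * phase (Complex.log (z x / phase ω)).im := by
      rw [← hn, Complex.log_im]
      exact eq_norm_mul_phase_arg _
    have h2 : ∀ a b : ℝ, phase (a + b) = phase a * phase b := fun a b => by
      rw [phase, phase, phase, ← Complex.exp_add]
      congr 1
      push_cast
      ring
    rw [h2, mul_left_comm, ← h1, mul_div_cancel₀ _ (phase_ne_zero ω)]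

/-- Valid on both sides of the branch cut: this is all that the delays and the matrix `B̂` require.
-/
theorem phase_log_im {z : ℂ} (hz : z ≠ 0) {θ : ℝ} (h : z = ‖z‖ * phase θ) :
    phase (Complex.log z).im = phase θ := by
  have h1 : z = ‖z‖ * phase (Complex.log z).im := by
    rw [Complex.log_im]
    exact eq_norm_mul_phase_arg z
  have h2 : (‖z‖ : ℂ) ≠ 0 := by exact_mod_cast norm_ne_zero_iff.2 hz
  exact mul_left_cancel₀ h2 (h1.symm.trans h)

/-- Spatial frequencies need equality of numbers, since the map on an angular region is injective
into frequencies and not into frequencies modulo `2π`. -/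
theorem log_im_eq {z : ℂ} (hz : z ≠ 0) {θ : ℝ} (h : z = ‖z‖ * phase θ)
    (hθ : θ ∈ Set.Ioc (-Real.pi) Real.pi) : (Complex.log z).im = θ := by
  rw [Complex.log_im, h, phase, mul_comm Complex.I, Complex.exp_mul_I]
  exact Complex.arg_mul_cos_add_sin_mul_I (norm_pos_iff.2 hz) hθ

theorem hasStrictFDerivAt_angleFreq (az el : ℝ) :
    HasStrictFDerivAt angleFreq
      ((((Real.pi * Real.cos az * Real.sin el) • ContinuousLinearMap.fst ℝ ℝ ℝ +
        (Real.pi * Real.sin az * Real.cos el) • ContinuousLinearMap.snd ℝ ℝ ℝ)).prod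
        ((-(Real.pi * Real.sin el)) • ContinuousLinearMap.snd ℝ ℝ ℝ)) (az, el) := by
  have h1 : HasStrictFDerivAt (fun x : ℝ × ℝ => x.1) (ContinuousLinearMap.fst ℝ ℝ ℝ) (az, el) :=
    hasStrictFDerivAt_fst
  have h2 : HasStrictFDerivAt (fun x : ℝ × ℝ => x.2) (ContinuousLinearMap.snd ℝ ℝ ℝ) (az, el) :=
    hasStrictFDerivAt_snd
  refine HasStrictFDerivAt.prodMk (((h1.sin.const_mul Real.pi).mul h2.sin).congr_fderiv ?_)
    ((h2.cos.const_mul Real.pi).congr_fderiv ?_)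
  · ext <;> simp
    ring
  · ext <;> simp

/-- First-order error of the angles obtained from perturbed spatial frequencies. -/
theorem angle_expansion (hr : Tendsto r 𝓕 (𝓝 0)) {s : Set (ℝ × ℝ)} (hs : IsOpen s)
    (hinj : Set.InjOn angleFreq s) {az el : ℝ} (hmem : (az, el) ∈ s)
    (haz : Real.cos az ≠ 0) (hel : Real.sin el ≠ 0) {y : α → ℝ × ℝ} {η₁ η₂ w₁ w₂ : α → ℝ}
    (hy : ∀ᶠ x in 𝓕, y x ∈ s ∧
      angleFreq (y x) = ((angleFreq (az, el)).1 + η₁ x, (angleFreq (az, el)).2 + η₂ x))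
    (hw₁ : w₁ =O[𝓕] r) (hw₂ : w₂ =O[𝓕] r)
    (hη₁ : (fun x => η₁ x - w₁ x) =o[𝓕] r) (hη₂ : (fun x => η₂ x - w₂ x) =o[𝓕] r) :
    (fun x => (y x).1 - az - (1 / (Real.pi * Real.cos az * Real.sin el) * w₁ x +
      Real.sin az * Real.cos el / (Real.pi * Real.cos az * Real.sin el ^ 2) * w₂ x)) =o[𝓕] r ∧
    (fun x => (y x).2 - el - -(1 / (Real.pi * Real.sin el)) * w₂ x) =o[𝓕] r := by
  have hpi := Real.pi_ne_zero
  -- The inverse of the triangular Jacobian; its entries are the coefficients in `kappaAz` and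
  -- `kappaEl`.
  let g : ℝ × ℝ →L[ℝ] ℝ × ℝ :=
    ((1 / (Real.pi * Real.cos az * Real.sin el)) • ContinuousLinearMap.fst ℝ ℝ ℝ +
      (Real.sin az * Real.cos el / (Real.pi * Real.cos az * Real.sin el ^ 2)) •
        ContinuousLinearMap.snd ℝ ℝ ℝ).prod
      ((-(1 / (Real.pi * Real.sin el))) • ContinuousLinearMap.snd ℝ ℝ ℝ)
  let f' : (ℝ × ℝ) ≃L[ℝ] ℝ × ℝ := ContinuousLinearEquiv.equivOfInverse
    ((((Real.pi * Real.cos az * Real.sin el) • ContinuousLinearMap.fst ℝ ℝ ℝ +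
        (Real.pi * Real.sin az * Real.cos el) • ContinuousLinearMap.snd ℝ ℝ ℝ)).prod
        ((-(Real.pi * Real.sin el)) • ContinuousLinearMap.snd ℝ ℝ ℝ)) g
    (fun x => by
      ext
      · simp [g]; field_simp; ring
      · simp [g]; field_simp)
    (fun x => by
      ext
      · simp [g]; field_simp; ring
      · simp [g]; field_simp)
  have hf : HasStrictFDerivAt angleFreq (f' : ℝ × ℝ →L[ℝ] ℝ × ℝ) (az, el) :=
    hasStrictFDerivAt_angleFreq az el
  have hηO₁ : η₁ =O[𝓕] r := by simpa using hη₁.isBigO.add hw₁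
  have hηO₂ : η₂ =O[𝓕] r := by simpa using hη₂.isBigO.add hw₂
  set v : α → ℝ × ℝ :=
    fun x => ((angleFreq (az, el)).1 + η₁ x, (angleFreq (az, el)).2 + η₂ x) with hv
  have hvO : (fun x => v x - angleFreq (az, el)) =O[𝓕] r := by
    refine (hηO₁.prod_left hηO₂).congr_left fun x => ?_
    ext <;> simp [hv]
  have hvlim : Tendsto v 𝓕 (𝓝 (angleFreq (az, el))) := by
    simpa using (hvO.trans_tendsto hr).add_const (angleFreq (az, el))
  have hinv := hf.to_localInverse
  have hloc : hf.localInverse angleFreq f' (az, el) (angleFreq (az, el)) = (az, el) :=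
    hf.localInverse_apply_image
  -- No continuity of `y` is assumed. Both points eventually lie in `s` and have the same
  -- frequencies, so injectivity identifies them.
  have hyeq : ∀ᶠ x in 𝓕, y x = hf.localInverse angleFreq f' (az, el) (v x) := by
    have h1 : Tendsto (fun x => hf.localInverse angleFreq f' (az, el) (v x)) 𝓕 (𝓝 (az, el)) := by
      have := hinv.hasFDerivAt.continuousAt.tendsto
      rw [hloc] at this
      exact this.comp hvlim
    filter_upwards [hy, hvlim.eventually hf.eventually_right_inverse,
      h1.eventually (hs.mem_nhds hmem)] with x hx h2 h3
    exact hinj hx.1 h3 (hx.2.trans h2.symm)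
  have hexp : (fun x => y x - (az, el) - g (v x - angleFreq (az, el))) =o[𝓕] r := by
    have h1 := ((hinv.hasFDerivAt.isLittleO).comp_tendsto hvlim).trans_isBigO hvO
    refine h1.congr' ?_ EventuallyEq.rfl
    filter_upwards [hyeq] with x hx
    simp only [Function.comp]
    rw [hloc, hx]
    rfl
  have hexp' : (fun x => y x - (az, el) - g (w₁ x, w₂ x)) =o[𝓕] r := by
    have h1 : (fun x => g (η₁ x - w₁ x, η₂ x - w₂ x)) =o[𝓕] r :=
      (g.isBigO_comp _ _).trans_isLittleO (hη₁.prod_left hη₂)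
    refine (hexp.add h1).congr_left fun x => ?_
    have : v x - angleFreq (az, el) = (w₁ x, w₂ x) + (η₁ x - w₁ x, η₂ x - w₂ x) := by
      ext <;> simp [hv]
    rw [this, map_add]
    abel
  refine ⟨?_, ?_⟩
  · refine (IsBigO.of_bound 1 (Eventually.of_forall fun x => ?_)).trans_isLittleO hexp'
    rw [one_mul]
    exact norm_fst_le (y x - (az, el) - g (w₁ x, w₂ x))
  · refine (IsBigO.of_bound 1 (Eventually.of_forall fun x => ?_)).trans_isLittleO hexp'
    rw [one_mul]
    exact norm_snd_le (y x - (az, el) - g (w₁ x, w₂ x))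

/-- First-order error of the delay obtained from a perturbed frequency modulo `2π`. -/
theorem delay_expansion (hr : Tendsto r 𝓕 (𝓝 0)) {Δf : ℝ} (hΔf : 0 < Δf) {s : Set ℝ}
    (hs : IsOpen s) (hinj : Set.InjOn (fun τ : ℝ => phase (-(2 * Real.pi * Δf * τ))) s) {τ : ℝ}
    (hmem : τ ∈ s) {y η w : α → ℝ}
    (hy : ∀ᶠ x in 𝓕, y x ∈ s ∧
      phase (-(2 * Real.pi * Δf * y x)) = phase (-(2 * Real.pi * Δf * τ) + η x))
    (hw : w =O[𝓕] r) (hη : (fun x => η x - w x) =o[𝓕] r) :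
    (fun x => y x - τ - -(1 / (2 * Real.pi * Δf)) * w x) =o[𝓕] r := by
  have hpi := Real.pi_ne_zero
  have hηO : η =O[𝓕] r := by simpa using hη.isBigO.add hw
  have hlim : Tendsto (fun x => τ + -(1 / (2 * Real.pi * Δf)) * η x) 𝓕 (𝓝 τ) := by
    simpa using ((hηO.trans_tendsto hr).const_mul (-(1 / (2 * Real.pi * Δf)))).const_add τ
  refine (hη.const_mul_left (-(1 / (2 * Real.pi * Δf)))).congr' ?_ EventuallyEq.rfl
  filter_upwards [hy, hlim.eventually (hs.mem_nhds hmem)] with x hx hx'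
  -- The frequency is linear in the delay, so the right side has exactly the required phase;
  -- openness puts it in `s`, and injectivity does the rest.
  have h1 : y x = τ + -(1 / (2 * Real.pi * Δf)) * η x := by
    refine hinj hx.1 hx' (hx.2.trans ?_)
    simp only
    congr 1
    field_simp
    ring
  rw [h1]
  ring

end FrequencyErrors

/-! ### Derivative of the beamspace matrix in the frequencies. -/

section BeamMatDerivative

variable {L : ℕ} {M N : Fin 4 → ℕ}

/-- The `n`-th coordinate of a real vector as a complex number. -/
noncomputable def coordCLM (n : Fin 5) : (Fin 5 → ℝ) →L[ℝ] ℂ :=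
  Complex.ofRealCLM.comp (ContinuousLinearMap.proj n)

theorem coordCLM_apply (n : Fin 5) (w : Fin 5 → ℝ) : coordCLM n w = (w n : ℂ) := rfl

theorem hasFDerivAt_exp_coord (c : ℂ) (n : Fin 5) (w : Fin 5 → ℝ) :
    HasFDerivAt (fun w : Fin 5 → ℝ => Complex.exp (c * (w n : ℝ)))
      ((c * Complex.exp (c * (w n : ℝ))) • coordCLM n) w := by
  have h1 : HasFDerivAt (fun w : Fin 5 → ℝ => ((w n : ℝ) : ℂ)) (coordCLM n) w :=
    (coordCLM n).hasFDerivAt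
  refine (h1.const_mul c).cexp.congr_fderiv ?_
  rw [smul_smul, mul_comm]

/-- The conjugate transpose turns the factor `-j` of `derivT` into `j`, so each summand contains the
derivative of `exp(jmω)`. -/
theorem derivT_mul_vander_apply {a : ℕ} {ι : Type*} (T : Matrix (Fin a) ι ℂ) (ω : Fin L → ℝ)
    (i : ι) (l : Fin L) : ((derivT T)ᴴ * vander a ω) i l =
      ∑ m : Fin a, star (T m i) *
        (Complex.I * (m : ℕ) * Complex.exp (Complex.I * (m : ℕ) * ω l)) := by
  rw [Matrix.mul_apply]
  refine Finset.sum_congr rfl fun m _ => ?_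
  simp only [derivT, vander, Matrix.conjTranspose_apply, Matrix.smul_apply, Matrix.diagonal_mul,
    Matrix.of_apply, smul_eq_mul, StarMul.star_mul, star_neg, Complex.star_def, Complex.conj_I,
    Complex.conj_natCast]
  ring

/-- Column `l` depends on the frequencies of path `l` alone, so it suffices to vary the five
frequencies `w` of one path; assigning `w` to every path keeps the matrix shape. -/
theorem hasFDerivAt_modeMat (T : ∀ k, Matrix (Fin (M k)) (Fin (N k)) ℂ) (ω : Fin L → Fin 5 → ℝ)
    (k : Fin 4) (a : Fin (N k)) (l : Fin L) :
    HasFDerivAt (fun w : Fin 5 → ℝ => modeMat T (fun _ : Fin L => w) k a l)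
      ((((derivT (T k))ᴴ * vander (M k) fun l => ω l k.castSucc) a l) • coordCLM k.castSucc)
      (ω l) := by
  have h1 : HasFDerivAt (fun w : Fin 5 → ℝ => ∑ m : Fin (M k), star (T k m a) *
      Complex.exp (Complex.I * (m : ℕ) * (w k.castSucc : ℝ)))
      (∑ m : Fin (M k), star (T k m a) • ((Complex.I * (m : ℕ) *
        Complex.exp (Complex.I * (m : ℕ) * (ω l k.castSucc : ℝ))) • coordCLM k.castSucc))
      (ω l) :=
    HasFDerivAt.fun_sum fun m _ => (hasFDerivAt_exp_coord _ _ _).const_mul _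
  refine h1.congr_fderiv ?_
  refine ContinuousLinearMap.ext fun w => ?_
  simp only [derivT_mul_vander_apply, sum_apply,
    smul_apply, smul_eq_mul, Finset.sum_mul, mul_assoc]

theorem hasFDerivAt_beamMat (T : ∀ k, Matrix (Fin (M k)) (Fin (N k)) ℂ) (ω : Fin L → Fin 5 → ℝ)
    (q : ℕ) (i : Idx N q) (l : Fin L) :
    HasFDerivAt (fun w : Fin 5 → ℝ => beamMat T (fun _ : Fin L => w) q i l)
      (∑ n, derivBeamMat T ω q n i l • coordCLM n) (ω l) := by
  have h1 := (HasFDerivAt.finsetProd (u := Finset.univ)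
    (fun k _ => hasFDerivAt_modeMat T ω k (i.1 k) l)).mul
    (hasFDerivAt_exp_coord (Complex.I * ((i.2 : ℕ) : ℂ)) (Fin.last 4) (ω l))
  refine h1.congr_fderiv ?_
  have hlast : derivBeamMat T ω q (Fin.last 4) i l =
      (∏ k, modeMat T ω k (i.1 k) l) * (Complex.I * ((i.2 : ℕ) : ℂ) *
        Complex.exp (Complex.I * ((i.2 : ℕ) : ℂ) * (ω l (Fin.last 4) : ℝ))) := by
    simp only [derivBeamMat, Fin.snoc_last, khatriRao, Matrix.of_apply]
    rw [derivT_mul_vander_apply, Finset.sum_eq_single i.2]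
    · simp
    · intro m _ hm
      simp [Matrix.one_apply_ne hm]
    · simp
  have hcast : ∀ k : Fin 4, derivBeamMat T ω q k.castSucc i l =
      ((derivT (T k))ᴴ * vander (M k) fun l => ω l k.castSucc) (i.1 k) l *
        (∏ j ∈ Finset.univ.erase k, modeMat T ω j (i.1 j) l) *
        Complex.exp (Complex.I * ((i.2 : ℕ) : ℂ) * (ω l (Fin.last 4) : ℝ)) := by
    intro k
    simp only [derivBeamMat, Fin.snoc_castSucc, khatriRao, Matrix.of_apply]
    rw [← Finset.mul_prod_erase _ _ (Finset.mem_univ k), Function.update_self]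
    refine congrArg₂ (· * ·) (congrArg₂ (· * ·) rfl (Finset.prod_congr rfl fun j hj => ?_)) rfl
    rw [Function.update_of_ne (Finset.ne_of_mem_erase hj)]
  rw [Fin.sum_univ_castSucc (fun n => derivBeamMat T ω q n i l • coordCLM n), hlast, add_comm, Finset.smul_sum]
  refine congrArg₂ (· + ·) (Finset.sum_congr rfl fun k _ => ?_) ?_
  · rw [hcast, smul_smul, smul_smul]
    congr 1
    have : ∀ j, modeMat T (fun _ : Fin L => ω l) j (i.1 j) l = modeMat T ω j (i.1 j) l :=
      fun _ => rfl
    simp only [this]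
    ring
  · rw [smul_smul]
    rfl

end BeamMatDerivative

/-! ### Least squares with a perturbed system matrix. -/

section GainErrors

variable {α m n : Type*} [Fintype m] [Fintype n] {𝓕 : Filter α} {r : α → ℝ}

theorem norm_mulVec_le (A : Matrix m n ℂ) (v : n → ℂ) :
    ‖A *ᵥ v‖ ≤ Fintype.card n * (‖A‖ * ‖v‖) := by
  refine (pi_norm_le_iff_of_nonneg (by positivity)).2 fun i => ?_
  refine (norm_sum_le _ _).trans ?_
  calc ∑ j, ‖A i j * v j‖ ≤ ∑ _j : n, ‖A‖ * ‖v‖ := by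
        refine Finset.sum_le_sum fun j _ => ?_
        rw [norm_mul]
        gcongr
        · exact Matrix.norm_entry_le_entrywise_sup_norm A
        · exact norm_le_pi_norm v j
    _ = _ := by simp

theorem isLittleO_mulVec {A : α → Matrix m n ℂ} {v : α → n → ℂ}
    (hA : Tendsto A 𝓕 (𝓝 0)) (hv : v =O[𝓕] r) : (fun x => A x *ᵥ v x) =o[𝓕] r := by
  have h : (fun x => A x *ᵥ v x) =O[𝓕] fun x => ‖A x‖ * ‖v x‖ :=
    IsBigO.of_bound (Fintype.card n) (Eventually.of_forall fun x => by
      simpa using norm_mulVec_le (A x) (v x))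
  refine h.trans_isLittleO ?_
  simpa using ((isLittleO_one_iff ℝ).2 (tendsto_zero_iff_norm_tendsto_zero.1 hA)).mul_isBigO
    hv.norm_left

theorem isLittleO_const_mulVec (A : Matrix m n ℂ) {v : α → n → ℂ} (hv : v =o[𝓕] r) :
    (fun x => A *ᵥ v x) =o[𝓕] r := by
  refine (IsBigO.of_bound (Fintype.card n * ‖A‖) (Eventually.of_forall fun x => ?_)).trans_isLittleO
    hv
  rw [mul_assoc]
  exact norm_mulVec_le A (v x)

/-- First-order error of a least-squares estimate with a perturbed system matrix. -/
theorem leastSquares_expansion (hr : Tendsto r 𝓕 (𝓝 0)) {L : ℕ} {B : Matrix m (Fin L) ℂ}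
    (hB : IsUnit (Bᴴ * B).det) {B' : α → Matrix m (Fin L) ℂ} {ι : Type*} [Fintype ι]
    {D : ι → Matrix m (Fin L) ℂ} {w : Fin L → ι → α → ℝ} (hw : ∀ l i, w l i =O[𝓕] r)
    (hB' : ∀ j l, (fun x => B' x j l - B j l - ∑ i, D i j l * w l i x) =o[𝓕] r)
    (γ : Fin L → ℂ) {δ : α → m → ℂ} (hδ : δ =O[𝓕] r) (l : Fin L) :
    (fun x => (pinv (B' x) *ᵥ (B *ᵥ γ + δ x)) l - γ l - ((pinv B *ᵥ δ x) l -
      ∑ i, (Matrix.of (fun a b => (pinv B * D i) a b * γ b) *ᵥ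
        fun l' => ((w l' i x : ℝ) : ℂ)) l)) =o[𝓕] r := by
  have hwO : ∀ l i, (fun x => ((w l i x : ℝ) : ℂ)) =O[𝓕] r := fun l i =>
    (Complex.isBigO_ofReal_left).2 (hw l i)
  set u : α → m → ℂ := fun x j => ∑ l', ∑ i, D i j l' * w l' i x * γ l' with hu
  have huO : u =O[𝓕] r := isBigO_pi.2 fun j => IsBigO.fun_sum fun l' _ => IsBigO.fun_sum fun i _ => by
    refine ((hwO l' i).const_mul_left (D i j l' * γ l')).congr_left fun x => ?_
    ring
  have hlim : Tendsto B' 𝓕 (𝓝 B) := by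
    refine tendsto_pi_nhds.2 fun j => tendsto_pi_nhds.2 fun l' => ?_
    have h1 : (fun x => B' x j l' - B j l') =O[𝓕] r := by
      have h2 : (fun x => ∑ i, D i j l' * ((w l' i x : ℝ) : ℂ)) =O[𝓕] r :=
        IsBigO.fun_sum fun i _ => (hwO l' i).const_mul_left _
      simpa using (hB' j l').isBigO.add h2
    simpa using (h1.trans_tendsto hr).add_const (B j l')
  have hp := tendsto_pinv hB hlim
  -- The data equal `B' γ + v`, and `pinv B'` is a left inverse of `B'`, so the error of the
  -- estimate is exactly `pinv B' v` with `v` of first order.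
  set v : α → m → ℂ := fun x => (B - B' x) *ᵥ γ + δ x with hv
  have hvu : (fun x => v x - (δ x - u x)) =o[𝓕] r := by
    refine isLittleO_pi.2 fun j => ?_
    have h1 : (fun x => ∑ l', -γ l' * (B' x j l' - B j l' - ∑ i, D i j l' * w l' i x)) =o[𝓕] r :=
      IsLittleO.fun_sum fun l' _ => (hB' j l').const_mul_left _
    refine h1.congr_left fun x => ?_
    simp only [hv, hu, Pi.sub_apply, Pi.add_apply, Matrix.mulVec, dotProduct, Matrix.sub_apply]
    rw [add_sub_assoc, sub_sub_cancel, ← Finset.sum_add_distrib]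
    refine Finset.sum_congr rfl fun l' _ => ?_
    rw [← Finset.sum_mul]
    ring
  have hvO : v =O[𝓕] r := by
    have := hvu.isBigO.add (hδ.sub huO)
    simpa using this
  have h1 : (fun x => (pinv (B' x) - pinv B) *ᵥ v x) =o[𝓕] r := by
    refine isLittleO_mulVec ?_ hvO
    have := hp.sub_const (pinv B)
    rwa [sub_self] at this
  have h2 := (h1.add (isLittleO_const_mulVec (pinv B) hvu))
  refine ((isLittleO_pi.1 h2) l).congr' ?_ EventuallyEq.rfl
  filter_upwards [eventually_isUnit_det hB (tendsto_gram hlim)] with x hx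
  have e1 : pinv (B' x) *ᵥ (B *ᵥ γ + δ x) = γ + pinv (B' x) *ᵥ v x := by
    have e2 : B *ᵥ γ + δ x = B' x *ᵥ γ + v x := by
      rw [hv]; simp only [Matrix.sub_mulVec]; abel
    rw [e2, Matrix.mulVec_add, Matrix.mulVec_mulVec, pinv_mul_self hx, Matrix.one_mulVec]
  have e3 : ∑ i, (Matrix.of (fun a b => (pinv B * D i) a b * γ b) *ᵥ
        fun l' => ((w l' i x : ℝ) : ℂ)) l = (pinv B *ᵥ u x) l := by
    simp only [Matrix.mulVec, dotProduct, Matrix.of_apply, Matrix.mul_apply, hu, Finset.sum_mul,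
      Finset.mul_sum]
    rw [Finset.sum_comm]
    conv_rhs => rw [Finset.sum_comm]
    refine Finset.sum_congr rfl fun l' _ => ?_
    rw [Finset.sum_comm]
    refine Finset.sum_congr rfl fun j _ => Finset.sum_congr rfl fun i _ => ?_
    ring
  rw [e1, e3, Matrix.sub_mulVec, Matrix.mulVec_sub, Matrix.mulVec_sub]
  simp only [Pi.add_apply, Pi.sub_apply]
  ring

end GainErrors

/-! ### Preparations for the main theorem. -/

section Assembly

variable {L : ℕ} {M N : Fin 4 → ℕ}

/-- The matrix sees frequencies only modulo `2π`, so the ambiguity of the delay frequency does not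
reach the gains. Different column labels are allowed for the sake of relabelling. -/
theorem beamMat_apply_congr (T : ∀ k, Matrix (Fin (M k)) (Fin (N k)) ℂ) {L' : ℕ}
    {ω : Fin L → Fin 5 → ℝ} {ω' : Fin L' → Fin 5 → ℝ} (q : ℕ) (i : Idx N q) {l : Fin L} {l' : Fin L'}
    (h : ∀ n, phase (ω l n) = phase (ω' l' n)) : beamMat T ω q i l = beamMat T ω' q i l' := by
  simp only [beamMat, khatriRao, modeMat, Matrix.of_apply, Matrix.mul_apply, vander_apply, h]

theorem beamMat_expansion {α : Type*} {𝓕 : Filter α} {r : α → ℝ} (hr : Tendsto r 𝓕 (𝓝 0))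
    (T : ∀ k, Matrix (Fin (M k)) (Fin (N k)) ℂ) (ω : Fin L → Fin 5 → ℝ) (q : ℕ)
    {η w : Fin L → Fin 5 → α → ℝ} (hw : ∀ l n, w l n =O[𝓕] r)
    (hη : ∀ l n, (fun x => η l n x - w l n x) =o[𝓕] r) (i : Idx N q) (l : Fin L) :
    (fun x => beamMat T (fun l n => ω l n + η l n x) q i l - beamMat T ω q i l -
      ∑ n, derivBeamMat T ω q n i l * w l n x) =o[𝓕] r := by
  have hηO : (fun x n => η l n x) =O[𝓕] r := isBigO_pi.2 fun n => by
    simpa using (hη l n).isBigO.add (hw l n)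
  have hlim : Tendsto (fun x => ω l + fun n => η l n x) 𝓕 (𝓝 (ω l)) := by
    simpa using (hηO.trans_tendsto hr).const_add (ω l)
  have h1 := ((hasFDerivAt_beamMat T ω q i l).isLittleO.comp_tendsto hlim).trans_isBigO
    (hηO.congr_left fun x => (add_sub_cancel_left (ω l) _).symm)
  have h2 : (fun x => ∑ n, derivBeamMat T ω q n i l * ((η l n x - w l n x : ℝ) : ℂ)) =o[𝓕] r :=
    IsLittleO.fun_sum fun n _ => (Complex.isLittleO_ofReal_left.2 (hη l n)).const_mul_left _
  refine (h1.add h2).congr_left fun x => ?_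
  simp only [Function.comp, add_sub_cancel_left, sum_apply, smul_apply, coordCLM_apply,
    smul_eq_mul, Complex.ofReal_sub, mul_sub, Finset.sum_sub_distrib]
  have e1 : beamMat T (fun _ : Fin L => ω l + fun n => η l n x) q i l =
      beamMat T (fun l n => ω l n + η l n x) q i l := beamMat_apply_congr T q i fun _ => rfl
  have e2 : beamMat T (fun _ : Fin L => ω l) q i l = beamMat T ω q i l :=
    beamMat_apply_congr T q i fun _ => rfl
  rw [e1, e2]
  ring

variable {ι : Type*} [Fintype ι]

theorem imPart_add (u v Δh : ι → ℂ) : imPart (u + v) Δh = imPart u Δh + imPart v Δh := by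
  rw [imPart, star_add, add_dotProduct, Complex.add_im]; rfl

theorem imPart_smul (c : ℝ) (u Δh : ι → ℂ) : imPart (c • u) Δh = c * imPart u Δh := by
  rw [imPart, star_smul, smul_dotProduct, star_trivial, Complex.smul_im]; rfl

theorem dotProduct_isBigO (u : ι → ℂ) (𝓕 : Filter (ι → ℂ)) :
    (fun Δh : ι → ℂ => u ⬝ᵥ Δh) =O[𝓕] fun Δh => ‖Δh‖ :=
  IsBigO.fun_sum fun i _ => IsBigO.const_mul_left (IsBigO.of_bound 1
    (Eventually.of_forall fun Δh => by simpa using norm_le_pi_norm Δh i)) _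

/-- The nonvanishing conditions that make the Jacobian invertible also keep `sin az` and `cos el`
away from `±1`, hence the spatial frequencies away from the branch cut at `±π`. -/
theorem angleFreq_mem_Ioo {az el : ℝ} (haz : Real.cos az ≠ 0) (hel : Real.sin el ≠ 0) :
    (angleFreq (az, el)).1 ∈ Set.Ioo (-Real.pi) Real.pi ∧
    (angleFreq (az, el)).2 ∈ Set.Ioo (-Real.pi) Real.pi := by
  have hpi := Real.pi_pos
  have h1 : |Real.sin az| < 1 := by
    rw [← sq_lt_one_iff_abs_lt_one]
    have := Real.sin_sq_add_cos_sq az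
    have := sq_pos_of_ne_zero haz
    linarith
  have h2 : |Real.cos el| < 1 := by
    rw [← sq_lt_one_iff_abs_lt_one]
    have := Real.sin_sq_add_cos_sq el
    have := sq_pos_of_ne_zero hel
    linarith
  have h3 : |Real.sin az * Real.sin el| < 1 := by
    rw [abs_mul]
    exact (mul_le_of_le_one_right (abs_nonneg _) (Real.abs_sin_le_one el)).trans_lt h1
  have key : ∀ x : ℝ, |x| < 1 → Real.pi * x ∈ Set.Ioo (-Real.pi) Real.pi := fun x hx => by
    obtain ⟨a, b⟩ := abs_lt.1 hx
    constructor <;> nlinarith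
  refine ⟨?_, key _ h2⟩
  rw [angleFreq, mul_assoc]
  exact key _ h3

end Assembly

end BeamESPRIT

/-! ### The perturbation formulas. -/

theorem lemma2 {L K₅ L₅ M₅ : ℕ} (hM₅ : L₅ + K₅ = M₅ + 1) {M N : Fin 4 → ℕ}
    (T : ∀ k, Matrix (Fin (M k)) (Fin (N k)) ℂ)
    (F Q : ∀ k, Matrix (Fin (N k)) (Fin (N k)) ℂ)
    (hT : ∀ k, BeamESPRIT.RestoresShiftInvariance (T k) (F k) (Q k))
    (Δf : ℝ) (hΔf : 0 < Δf) (R : BeamESPRIT.ParamRegion Δf)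
    (p : BeamESPRIT.ChannelParams L) (hp : R.Contains p)
    (hφ : ∀ l, Real.cos (p.phiAz l) ≠ 0 ∧ Real.sin (p.phiEl l) ≠ 0)
    (hθ : ∀ l, Real.cos (p.thetaAz l) ≠ 0 ∧ Real.sin (p.thetaEl l) ≠ 0)
    (hγ : ∀ l, p.gain l ≠ 0)
    (hJ : ∀ k, (BeamESPRIT.J₁ Q K₅ k * BeamESPRIT.beamMat T (p.freq Δf) K₅).rank = L)
    (hJ₅ : (BeamESPRIT.J₁freq N K₅ * BeamESPRIT.beamMat T (p.freq Δf) K₅).rank = L)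
    (hG : (BeamESPRIT.vander L₅ fun l => p.freq Δf l 4).rank = L)
    (β : Fin 5 → ℂ)
    (hβ : Function.Injective fun l => ∑ n, β n * BeamESPRIT.phase (p.freq Δf l n))
    (est : (BeamESPRIT.Idx N M₅ → ℂ) → BeamESPRIT.ChannelParams L)
    (hest : ∀ᶠ Δh in 𝓝 (0 : BeamESPRIT.Idx N M₅ → ℂ),
      BeamESPRIT.IsESPRITOutput T F Q R K₅ L₅ β
        (BeamESPRIT.channel T Δf M₅ p + Δh) (est Δh)) :
    ∃ σ : (BeamESPRIT.Idx N M₅ → ℂ) → Equiv.Perm (Fin L), ∀ l,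
      ((fun Δh => (est Δh).phiAz (σ Δh l) - p.phiAz l -
          BeamESPRIT.imPart (BeamESPRIT.kappa T F Q K₅ L₅ Δf p l 0) Δh)
        =o[𝓝 0] fun Δh => Δh) ∧
      ((fun Δh => (est Δh).phiEl (σ Δh l) - p.phiEl l -
          BeamESPRIT.imPart (BeamESPRIT.kappa T F Q K₅ L₅ Δf p l 1) Δh)
        =o[𝓝 0] fun Δh => Δh) ∧
      ((fun Δh => (est Δh).thetaAz (σ Δh l) - p.thetaAz l -
          BeamESPRIT.imPart (BeamESPRIT.kappa T F Q K₅ L₅ Δf p l 2) Δh)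
        =o[𝓝 0] fun Δh => Δh) ∧
      ((fun Δh => (est Δh).thetaEl (σ Δh l) - p.thetaEl l -
          BeamESPRIT.imPart (BeamESPRIT.kappa T F Q K₅ L₅ Δf p l 3) Δh)
        =o[𝓝 0] fun Δh => Δh) ∧
      ((fun Δh => (est Δh).tau (σ Δh l) - p.tau l -
          BeamESPRIT.imPart (BeamESPRIT.kappa T F Q K₅ L₅ Δf p l 4) Δh)
        =o[𝓝 0] fun Δh => Δh) ∧
      ((fun Δh => (est Δh).gain (σ Δh l) - p.gain l -
          BeamESPRIT.gainPerturbation T F Q K₅ L₅ Δf p l Δh)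
        =o[𝓝 0] fun Δh => Δh) := by
  have hr : Tendsto (fun Δh : BeamESPRIT.Idx N M₅ → ℂ => ‖Δh‖) (𝓝 0) (𝓝 0) := tendsto_norm_zero
  -- The internal data of the algorithm are chosen for every `Δh`, with zeros as dummy values where
  -- `est Δh` is not an output.
  have hex : ∀ Δh : BeamESPRIT.Idx N M₅ → ℂ,
      ∃ (U : Matrix (BeamESPRIT.Idx N K₅) (Fin L) ℂ) (E : Matrix (Fin L) (Fin L) ℂ)
        (lam : Fin L → ℂ) (ωhat : Fin L → Fin 5 → ℝ),
      BeamESPRIT.IsESPRITOutput T F Q R K₅ L₅ β (BeamESPRIT.channel T Δf M₅ p + Δh) (est Δh) →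
      BeamESPRIT.IsLeadingLeftSingular
        (BeamESPRIT.smooth K₅ L₅ (BeamESPRIT.channel T Δf M₅ p + Δh)) U ∧
      IsUnit E.det ∧
      ∑ n, β n • BeamESPRIT.shiftMat F Q U n = E * Matrix.diagonal lam * E⁻¹ ∧
      (∀ l n, ωhat l n = (Complex.log ((E⁻¹ * BeamESPRIT.shiftMat F Q U n * E) l l)).im) ∧
      R.Contains (est Δh) ∧
      (∀ l, BeamESPRIT.angleFreq ((est Δh).phiAz l, (est Δh).phiEl l) = (ωhat l 0, ωhat l 1)) ∧
      (∀ l, BeamESPRIT.angleFreq ((est Δh).thetaAz l, (est Δh).thetaEl l) =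
        (ωhat l 2, ωhat l 3)) ∧
      (∀ l, BeamESPRIT.phase (-(2 * Real.pi * Δf * (est Δh).tau l)) =
        BeamESPRIT.phase (ωhat l 4)) ∧
      (est Δh).gain = BeamESPRIT.pinv (BeamESPRIT.beamMat T ωhat M₅) *ᵥ
        (BeamESPRIT.channel T Δf M₅ p + Δh) := by
    intro Δh
    by_cases h : BeamESPRIT.IsESPRITOutput T F Q R K₅ L₅ β
      (BeamESPRIT.channel T Δf M₅ p + Δh) (est Δh)
    · obtain ⟨U, E, lam, ωhat, hout⟩ := h
      exact ⟨U, E, lam, ωhat, fun _ => hout⟩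
    · exact ⟨0, 0, 0, 0, fun h' => (h h').elim⟩
  choose U E lam ωhat hout using hex
  replace hout := hest.mono fun Δh h => hout Δh h
  obtain ⟨σ, hσ⟩ := BeamESPRIT.diagonal_entries_expansion hM₅ hT hγ hJ hJ₅ hG hβ
    (hout.mono fun _ h => h.1) (hout.mono fun _ h => ⟨h.2.1, h.2.2.1⟩)
  refine ⟨σ, ?_⟩
  set ω := p.freq Δf with hω
  set w : Fin L → Fin 5 → (BeamESPRIT.Idx N M₅ → ℂ) → ℝ := fun l n Δh =>
    BeamESPRIT.imPart (BeamESPRIT.upsilon T F Q K₅ L₅ ω p.gain l n) Δh with hw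
  set z : Fin L → Fin 5 → (BeamESPRIT.Idx N M₅ → ℂ) → ℂ := fun l n Δh =>
    ((E Δh)⁻¹ * BeamESPRIT.shiftMat F Q (U Δh) n * E Δh) (σ Δh l) (σ Δh l) with hz
  -- This deviation tends to zero in all modes, whereas `ωhat - ω` may differ from it by a multiple
  -- of `2π` in the delay mode.
  set η : Fin L → Fin 5 → (BeamESPRIT.Idx N M₅ → ℂ) → ℝ := fun l n Δh =>
    (Complex.log (z l n Δh / BeamESPRIT.phase (ω l n))).im with hη
  have hlog := fun l n => BeamESPRIT.log_im_expansion hr (z := z l n)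
    (BeamESPRIT.dotProduct_isBigO _ _) (hσ l n)
  have hwO : ∀ l n, w l n =O[𝓝 0] fun Δh => ‖Δh‖ := fun l n =>
    (IsBigO.of_bound 1 (Eventually.of_forall fun Δh => by
      rw [one_mul]; exact Complex.abs_im_le_norm _)).trans
      (BeamESPRIT.dotProduct_isBigO (star (BeamESPRIT.upsilon T F Q K₅ L₅ ω p.gain l n)) _)
  have hηw : ∀ l n, (fun Δh => η l n Δh - w l n Δh) =o[𝓝 0] fun Δh => ‖Δh‖ :=
    fun l n => (hlog l n).1
  have hη0 : ∀ l n, Tendsto (η l n) (𝓝 0) (𝓝 0) := fun l n => by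
    have h1 : η l n =O[𝓝 0] fun Δh => ‖Δh‖ := by simpa using (hηw l n).isBigO.add (hwO l n)
    exact h1.trans_tendsto hr
  have hphase : ∀ᶠ Δh in 𝓝 (0 : BeamESPRIT.Idx N M₅ → ℂ), ∀ l n,
      BeamESPRIT.phase (ωhat Δh (σ Δh l) n) = BeamESPRIT.phase (ω l n + η l n Δh) := by
    refine eventually_all.2 fun l => eventually_all.2 fun n => ?_
    filter_upwards [hout, (hlog l n).2] with Δh h1 h2
    rw [h1.2.2.2.1]
    exact BeamESPRIT.phase_log_im h2.1 h2.2
  have hfreq : ∀ l n, ω l n ∈ Set.Ioo (-Real.pi) Real.pi →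
      ∀ᶠ Δh in 𝓝 (0 : BeamESPRIT.Idx N M₅ → ℂ), ωhat Δh (σ Δh l) n = ω l n + η l n Δh := by
    intro l n hln
    have h3 : Tendsto (fun Δh => ω l n + η l n Δh) (𝓝 0) (𝓝 (ω l n)) := by
      simpa using (hη0 l n).const_add (ω l n)
    filter_upwards [hout, (hlog l n).2, h3.eventually (isOpen_Ioo.mem_nhds hln)] with Δh h1 h2 h3
    rw [h1.2.2.2.1]
    exact BeamESPRIT.log_im_eq h2.1 h2.2 (Set.Ioo_subset_Ioc_self h3)
  intro l
  obtain ⟨hφ₁, hφ₂⟩ := BeamESPRIT.angleFreq_mem_Ioo (hφ l).1 (hφ l).2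
  obtain ⟨hθ₁, hθ₂⟩ := BeamESPRIT.angleFreq_mem_Ioo (hθ l).1 (hθ l).2
  obtain ⟨hp₁, hp₂, hp₃⟩ := hp l
  have hdep := BeamESPRIT.angle_expansion hr R.isOpen_departure R.injOn_departure hp₁ (hφ l).1
    (hφ l).2 (y := fun Δh => ((est Δh).phiAz (σ Δh l), (est Δh).phiEl (σ Δh l)))
    (by
      filter_upwards [hout, hfreq l 0 hφ₁, hfreq l 1 hφ₂] with Δh h1 h2 h3
      refine ⟨(h1.2.2.2.2.1 _).1, ?_⟩
      rw [h1.2.2.2.2.2.1, h2, h3]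
      rfl) (hwO l 0) (hwO l 1) (hηw l 0) (hηw l 1)
  have harr := BeamESPRIT.angle_expansion hr R.isOpen_arrival R.injOn_arrival hp₂ (hθ l).1
    (hθ l).2 (y := fun Δh => ((est Δh).thetaAz (σ Δh l), (est Δh).thetaEl (σ Δh l)))
    (by
      filter_upwards [hout, hfreq l 2 hθ₁, hfreq l 3 hθ₂] with Δh h1 h2 h3
      refine ⟨(h1.2.2.2.2.1 _).2.1, ?_⟩
      rw [h1.2.2.2.2.2.2.1, h2, h3]
      rfl) (hwO l 2) (hwO l 3) (hηw l 2) (hηw l 3)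
  have hdel := BeamESPRIT.delay_expansion hr hΔf R.isOpen_delay R.injOn_delay hp₃
    (y := fun Δh => (est Δh).tau (σ Δh l))
    (by
      filter_upwards [hout, hphase] with Δh h1 h2
      refine ⟨(h1.2.2.2.2.1 _).2.2, ?_⟩
      rw [h1.2.2.2.2.2.2.2.1, h2]
      rfl) (hwO l 4) (hηw l 4)
  have hB : IsUnit ((BeamESPRIT.beamMat T ω M₅)ᴴ * BeamESPRIT.beamMat T ω M₅).det := by
    -- A path `l` exists, so `L` is positive and the rank of `G` forces a row; hence `K₅ ≤ M₅`.
    have h1 : 1 ≤ L₅ := by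
      have h2 := (BeamESPRIT.vander L₅ fun l => ω l 4).rank_le_card_height
      rw [hG, Fintype.card_fin] at h2
      have := l.pos
      omega
    refine BeamESPRIT.isUnit_det_gram_beamMat (q := K₅) (by omega) ?_
    refine BeamESPRIT.isUnit_det_gram_of_left_inverse
      (X := BeamESPRIT.pinv (BeamESPRIT.J₁freq N K₅ * BeamESPRIT.beamMat T ω K₅) *
        BeamESPRIT.J₁freq N K₅) ?_
    rw [Matrix.mul_assoc]
    exact BeamESPRIT.pinv_mul_self (BeamESPRIT.isUnit_det_gram_of_rank (by simpa using hJ₅))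
  have hgain := BeamESPRIT.leastSquares_expansion hr hB hwO
    (fun i l => BeamESPRIT.beamMat_expansion hr T ω M₅ hwO hηw i l) p.gain
    (isBigO_refl (fun Δh : BeamESPRIT.Idx N M₅ → ℂ => Δh) _).norm_right l
  refine ⟨hdep.1.of_norm_right.congr_left fun Δh => ?_,
    hdep.2.of_norm_right.congr_left fun Δh => ?_,
    harr.1.of_norm_right.congr_left fun Δh => ?_,
    harr.2.of_norm_right.congr_left fun Δh => ?_,
    hdel.of_norm_right.congr_left fun Δh => ?_,
    hgain.of_norm_right.congr' ?_ EventuallyEq.rfl⟩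
  · rw [← BeamESPRIT.imPart_smul, ← BeamESPRIT.imPart_smul, ← BeamESPRIT.imPart_add]; rfl
  · rw [← BeamESPRIT.imPart_smul]; rfl
  · rw [← BeamESPRIT.imPart_smul, ← BeamESPRIT.imPart_smul, ← BeamESPRIT.imPart_add]; rfl
  · rw [← BeamESPRIT.imPart_smul]; rfl
  · rw [← BeamESPRIT.imPart_smul]; rfl
  · filter_upwards [hout, hphase] with Δh h1 h2
    have h3 : (est Δh).gain (σ Δh l) = (BeamESPRIT.pinv
        (BeamESPRIT.beamMat T (fun l n => ω l n + η l n Δh) M₅) *ᵥ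
          (BeamESPRIT.beamMat T ω M₅ *ᵥ p.gain + Δh)) l := by
      -- Equal phases make `B̂` a column permutation of the matrix at the frequencies `ω + η`, to
      -- which the least-squares expansion applies.
      have h4 : BeamESPRIT.beamMat T (fun l n => ω l n + η l n Δh) M₅ =
          (BeamESPRIT.beamMat T (ωhat Δh) M₅).submatrix id (σ Δh) := by
        ext i l'
        exact BeamESPRIT.beamMat_apply_congr T M₅ i fun n => (h2 l' n).symm
      rw [h1.2.2.2.2.2.2.2.2, h4, BeamESPRIT.pinv_submatrix_right]
      rfl
    rw [h3]
    rfl
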